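/- **Theorem 1.4.** All groups are finite and $G$ is a group. For a subgroup $A$ of $G$ let $A^G$ be its normal closure and $A_G$ its normal core in $G$. For a class $\mathfrak F$ of groups (closed under isomorphism and containing all identity groups), $G^{\mathfrak F}$ is the $\mathfrak F$-residual of $G$, the intersection of all normal subgroups $N$ of $G$ with $G/N\in\mathfrak F$. The class $\mathfrak F$ is *normally hereditary* if $H\trianglelefteq X\in\mathfrak F$ implies $H\in\mathfrak F$; it is a *formation* if for every group $X$ every homomorphic image of $X/X^{\mathfrak F}$ is in $\mathfrak F$; it is *saturated* if $X^{\mathfrak F}\le\Phi(X)$ implies $X\in\mathfrak F$, where $\Phi$ denotes the Frattini subgroup. A chief factor $H/K$ of $G$ is *$\mathfrak F$-central* if $(H/K)\rtimes(G/C_G(H/K))\in\mathfrak F$, and *central* if $H/K\le Z(G/K)$. Let $\mathcal L_{\mathfrak F}(G)$ be the set of all subgroups $A$ of $G$ with $A^G/A_G\in\mathfrak F$. For a set $\Delta$ of chief factors of $G$ let $\mathcal L_\Delta(G)$ be the set of all subgroups $A$ of $G$ such that every chief factor $H/K$ of $G$ with $A_G\le K<H\le A^G$ belongs to $\Delta$.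 Let $\mathfrak N$ be the class of all nilpotent groups. A *power automorphism* of a group is an automorphism that maps every subgroup onto itself. (i) Let $\mathfrak F$ be a normally hereditary saturated formation containing all nilpotent groups, and let $\Delta$ be the set of all $\mathfrak F$-central chief factors of $G$. If $D=G^{\mathfrak F}$ is soluble and $\mathcal L_{\mathfrak F}(G)\subseteq\mathcal L_\Delta(G)$, then $D$ is an abelian Hall subgroup of odd order of $G$, every element of $G$ induces by conjugation a power automorphism on $D/\Phi(D)$, and every chief factor $H/K$ of $G$ with $H\le D$ is cyclic. (ii) Let $G$ be soluble and let $\Delta$ be the set of all central chief factors of $G$. If $\mathcal L_{\mathfrak N}(G)=\mathcal L_\Delta(G)$, then every element of $G$ induces by conjugation a power automorphism on $G^{\mathfrak N}$. -/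

import Mathlib

universe u

noncomputable section

/-- A class of finite groups: a property of groups that holds only for finite groups,
is invariant under isomorphism and holds for all identity groups. -/
structure GroupClass where
  Mem : (G : Type u) → [Group G] → Prop
  finite_of_mem : ∀ (G : Type u) [Group G], Mem G → Finite G
  mem_of_mulEquiv : ∀ (G H : Type u) [Group G] [Group H], (G ≃* H) → Mem G → Mem H
  mem_of_subsingleton : ∀ (G : Type u) [Group G], Subsingleton G → Mem G

namespace GroupClass

/-- The class of all finite nilpotent groups. -/
def nilpotent : GroupClass.{u} where
  Mem G _ := Finite G ∧ Group.IsNilpotent G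
  finite_of_mem _ _ h := h.1
  mem_of_mulEquiv G _ _ _ e h := by
    obtain ⟨h₁, h₂⟩ := h
    exact ⟨Finite.of_equiv G e.toEquiv, Group.nilpotent_of_mulEquiv e⟩
  mem_of_subsingleton _ _ _ := ⟨inferInstance, inferInstance⟩

/-- The residual of `G`: the intersection of all normal subgroups `N` of `G` such that
`G ⧸ N` is in the class. -/
def residual (F : GroupClass.{u}) (G : Type u) [Group G] : Subgroup G :=
  ⨅ (N : Subgroup G) (_ : N.Normal) (_ : F.Mem (G ⧸ N)), N

instance residual_normal (F : GroupClass.{u}) (G : Type u) [Group G] :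
    (F.residual G).Normal := by
  unfold residual
  exact Subgroup.normal_iInf_normal fun _ => Subgroup.normal_iInf_normal fun h =>
    Subgroup.normal_iInf_normal fun _ => h

/-- Closed under normal subgroups. -/
def NormallyHereditary (F : GroupClass.{u}) : Prop :=
  ∀ (G : Type u) [Group G], F.Mem G → ∀ H : Subgroup G, H.Normal → F.Mem H

/-- Every homomorphic image of the quotient of a finite group by its residual is in the class. -/
def IsFormation (F : GroupClass.{u}) : Prop :=
  ∀ (G : Type u) [Group G] [Finite G] (Q : Type u) [Group Q] (f : (G ⧸ F.residual G) →* Q),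
    Function.Surjective f → F.Mem Q

/-- A finite group whose residual lies in its Frattini subgroup is in the class. -/
def IsSaturated (F : GroupClass.{u}) : Prop :=
  ∀ (G : Type u) [Group G] [Finite G], F.residual G ≤ frattini G → F.Mem G

end GroupClass

/-- A normal section `num / den` of `G`: a pair of normal subgroups `den ≤ num` of `G`. -/
structure NormalSection (G : Type u) [Group G] where
  num : Subgroup G
  den : Subgroup G
  num_normal : num.Normal
  den_normal : den.Normal
  den_le_num : den ≤ num

namespace NormalSection

variable {G : Type u} [Group G]

instance (S : NormalSection G) : S.num.Normal := S.num_normal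

instance (S : NormalSection G) : S.den.Normal := S.den_normal

/-- The group `num / den`. -/
abbrev Factor (S : NormalSection G) : Type u := S.num ⧸ S.den.subgroupOf S.num

theorem map_conjNormal_den (S : NormalSection G) (g : G) :
    (S.den.subgroupOf S.num).map (MulAut.conjNormal g : MulAut S.num).toMonoidHom =
      S.den.subgroupOf S.num := by
  ext x
  constructor
  · rintro ⟨y, hy, rfl⟩
    exact S.den_normal.conj_mem _ hy g
  · intro hx
    refine ⟨(MulAut.conjNormal g⁻¹ : MulAut S.num) x, ?_, ?_⟩
    · exact S.den_normal.conj_mem _ hx g⁻¹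
    · apply Subtype.ext
      simp

/-- The action of `G` on `num / den` by conjugation: `g` sends `x den` to `g x g⁻¹ den`. -/
def conj (S : NormalSection G) : G →* MulAut S.Factor where
  toFun g := QuotientGroup.congr _ _ (MulAut.conjNormal g) (S.map_conjNormal_den g)
  map_one' := by
    ext x
    induction x using QuotientGroup.induction_on with
    | H x => simp [QuotientGroup.congr_mk]
  map_mul' a b := by
    ext x
    induction x using QuotientGroup.induction_on with
    | H x =>
      change ((MulAut.conjNormal (a * b) x : S.num) : S.Factor) =
        ((MulAut.conjNormal a (MulAut.conjNormal b x) : S.num) : S.Factor)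
      rw [map_mul]
      rfl

/-- The centralizer `C_G(num / den)`: the elements of `G` acting trivially on `num / den`. -/
abbrev cent (S : NormalSection G) : Subgroup G := S.conj.ker

/-- The semidirect product `(num / den) ⋊ (G / C_G(num / den))`. -/
abbrev Semidirect (S : NormalSection G) : Type u :=
  S.Factor ⋊[QuotientGroup.kerLift S.conj] (G ⧸ S.cent)

/-- `num / den` is a chief factor of `G`, i.e. a minimal normal subgroup of `G / den`. -/
def IsChief (S : NormalSection G) : Prop :=
  S.den < S.num ∧ ∀ N : Subgroup G, N.Normal → S.den ≤ N → N ≤ S.num → N = S.den ∨ N = S.num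

/-- `num / den ≤ Z(G / den)`. -/
def IsCentral (S : NormalSection G) : Prop :=
  S.num.map (QuotientGroup.mk' S.den) ≤ Subgroup.center (G ⧸ S.den)

/-- `(num / den) ⋊ (G / C_G(num / den))` is in the class `F`. -/
def IsCentralFor (F : GroupClass.{u}) (S : NormalSection G) : Prop :=
  F.Mem S.Semidirect

/-- `num / den ≤ Z_Δ(G)`: every chief factor of `G` between `den` and `num` is in `Δ`
(this is vacuous if `den = num`). -/
def LeZ (S : NormalSection G) (Δ : Set (NormalSection G)) : Prop :=
  ∀ C : NormalSection G, C.IsChief → S.den ≤ C.den → C.num ≤ S.num → C ∈ Δ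

/-- The normal section `A^G / A_G`: the normal closure of `A` over the normal core of `A`. -/
def closureModCore (A : Subgroup G) : NormalSection G where
  num := Subgroup.normalClosure (A : Set G)
  den := A.normalCore
  num_normal := Subgroup.normalClosure_normal
  den_normal := A.normalCore_normal
  den_le_num := A.normalCore_le.trans Subgroup.le_normalClosure

end NormalSection

/-- `L_Δ(G)`: the subgroups `A` of `G` with `A^G / A_G ≤ Z_Δ(G)`. -/
def latticeOfSections {G : Type u} [Group G] (Δ : Set (NormalSection G)) : Set (Subgroup G) :=
  {A | (NormalSection.closureModCore A).LeZ Δ}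

/-- `L_F(G)`: the subgroups `A` of `G` with `A^G / A_G` in `F`. -/
def latticeOfClass (F : GroupClass.{u}) (G : Type u) [Group G] : Set (Subgroup G) :=
  {A | F.Mem (NormalSection.closureModCore A).Factor}

/-- The set of all `F`-central chief factors of `G`. -/
def chiefFactorsCentralFor (F : GroupClass.{u}) (G : Type u) [Group G] :
    Set (NormalSection G) :=
  {C | C.IsChief ∧ C.IsCentralFor F}

/-- The set of all central chief factors of `G`. -/
def centralChiefFactors (G : Type u) [Group G] : Set (NormalSection G) :=
  {C | C.IsChief ∧ C.IsCentral}

/-- A Hall subgroup: its order and its index are coprime. -/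
def IsHallSubgroup {G : Type u} [Group G] (H : Subgroup G) : Prop :=
  (Nat.card H).Coprime H.index

/-- A power automorphism: an automorphism mapping every subgroup onto itself. -/
def IsPowerAutomorphism {H : Type u} [Group H] (α : MulAut H) : Prop :=
  ∀ K : Subgroup H, K.map α.toMonoidHom = K

/-- The automorphism of `D / Φ(D)` induced by conjugation by `g` for a normal subgroup `D`. -/
def conjModFrattini {G : Type u} [Group G] (D : Subgroup G) [D.Normal] (g : G) :
    MulAut (D ⧸ frattini D) :=
  QuotientGroup.congr (frattini D) (frattini D) (MulAut.conjNormal g)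
    (Subgroup.characteristic_iff_map_eq.mp inferInstance _)

end

/-! Write `D` for the residual. A chief factor `H/K` with `H ≤ D` is abelian, so for `x ∈ H \ K` the
subgroup `A = ⟨x⟩K` has abelian `A^G/A_G` and lies in `latticeOfClass`. If `H/K` is not `F`-central
this forces `A` to be normal, so `A = H` and `H/K` is cyclic. In both the cyclic and the `F`-central
case `D` centralizes `H/K`; hence `D` is nilpotent (`residual_isNilpotent`), and every subgroup of
`D` belongs to `latticeOfClass`.

The core is `not_isCentralFor_of_num_le_residual`: no chief factor below `D` is `F`-central. An
`F`-central one with maximal denominator becomes, modulo that denominator, the only minimal normal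
subgroup `R` below the residual. Saturation gives `R ≠ D`. A chief factor `S/R` below `D` then has
`S` cyclic, and the power map with exponent `|R|` identifies `S/R` with `R` as a `G`-group, so `S/R`
is `F`-central too, against maximality.

Consequently every subgroup of `D` is normal in `G` (`normal_of_le_residual`), which gives the power
automorphisms. `D` acts trivially on its cyclic subgroups, so it is abelian; a subgroup of order 2
would be central, so `|D|` is odd. If `D` were not Hall, a quotient would have residual of prime
order `p` dividing its index; a diagonal subgroup of order `p` in the centralizer of that residual
then yields a contradiction (`not_dvd_index_residual_of_card_prime`). The second statement follows
from the same normality result, since nilpotent groups form a saturated formation and central chief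
factors are central for it. -/

/-! ### Residuals and membership in a formation. -/

namespace GroupClass

variable {F : GroupClass.{u}} {G : Type u} [Group G]

theorem Mem.of_mulEquiv {H : Type u} [Group H] (h : F.Mem G) (e : G ≃* H) : F.Mem H :=
  F.mem_of_mulEquiv G H e h

theorem residual_le {N : Subgroup G} [hN : N.Normal] (h : F.Mem (G ⧸ N)) : F.residual G ≤ N :=
  iInf_le_of_le N (iInf_le_of_le hN (iInf_le_of_le h le_rfl))

/-- A homomorphic image of a finite group is in the formation if and only if the kernel contains
the residual. -/
theorem mem_iff_residual_le_ker [Finite G] (hF : F.IsFormation) {Q : Type u} [Group Q]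
    (f : G →* Q) (hf : Function.Surjective f) : F.Mem Q ↔ F.residual G ≤ f.ker := by
  constructor
  · intro h
    exact residual_le (h.of_mulEquiv (QuotientGroup.quotientKerEquivOfSurjective f hf).symm)
  · intro h
    exact hF G Q (QuotientGroup.lift _ f h)
      (QuotientGroup.lift_surjective_of_surjective _ f hf h)

theorem mem_quotient_iff [Finite G] (hF : F.IsFormation) (N : Subgroup G) [N.Normal] :
    F.Mem (G ⧸ N) ↔ F.residual G ≤ N := by
  rw [mem_iff_residual_le_ker hF (QuotientGroup.mk' N) (QuotientGroup.mk'_surjective N),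
    QuotientGroup.ker_mk']

theorem mem_iff_residual_eq_bot [Finite G] (hF : F.IsFormation) :
    F.Mem G ↔ F.residual G = ⊥ := by
  rw [mem_iff_residual_le_ker hF (MonoidHom.id G) Function.surjective_id, MonoidHom.ker_id,
    le_bot_iff]

theorem Mem.of_surjective [Finite G] (hF : F.IsFormation) (h : F.Mem G) {Q : Type u} [Group Q]
    (f : G →* Q) (hf : Function.Surjective f) : F.Mem Q := by
  rw [mem_iff_residual_le_ker hF f hf, (mem_iff_residual_eq_bot hF).1 h]
  exact bot_le

theorem map_residual [Finite G] (hF : F.IsFormation) {G' : Type u} [Group G'] (π : G →* G')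
    (hπ : Function.Surjective π) : (F.residual G).map π = F.residual G' := by
  have : Finite G' := Finite.of_surjective π hπ
  apply le_antisymm
  · rw [Subgroup.map_le_iff_le_comap]
    have h := (mem_quotient_iff hF (F.residual G')).2 le_rfl
    rw [mem_iff_residual_le_ker hF ((QuotientGroup.mk' (F.residual G')).comp π)
      ((QuotientGroup.mk'_surjective _).comp hπ)] at h
    rwa [← MonoidHom.comap_ker, QuotientGroup.ker_mk'] at h
  · have : ((F.residual G).map π).Normal := Subgroup.Normal.map inferInstance π hπ
    apply residual_le
    rw [mem_iff_residual_le_ker hF ((QuotientGroup.mk' ((F.residual G).map π)).comp π)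
      ((QuotientGroup.mk'_surjective _).comp hπ), ← MonoidHom.comap_ker, QuotientGroup.ker_mk']
    exact Subgroup.le_comap_map _ _

end GroupClass

/-! ### Transport of `F`-centrality between normal sections. -/

namespace NormalSection

variable {F : GroupClass.{u}} {G : Type u} [Group G]

theorem conj_mk (S : NormalSection G) (g : G) (x : S.num) :
    S.conj g (x : S.Factor) = ((MulAut.conjNormal g x : S.num) : S.Factor) :=
  rfl

theorem mem_cent_iff (S : NormalSection G) {g : G} :
    g ∈ S.cent ↔ ∀ x ∈ S.num, x⁻¹ * (g * x * g⁻¹) ∈ S.den := by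
  rw [MonoidHom.mem_ker]
  constructor
  · intro h x hx
    have h1 := DFunLike.congr_fun h ((⟨x, hx⟩ : S.num) : S.Factor)
    rw [conj_mk, MulAut.one_apply, eq_comm, QuotientGroup.eq] at h1
    exact h1
  · intro h
    ext x
    induction x using QuotientGroup.induction_on with
    | H x =>
      rw [conj_mk, MulAut.one_apply, eq_comm, QuotientGroup.eq]
      exact h x x.2

theorem den_le_cent (S : NormalSection G) : S.den ≤ S.cent := fun g hg =>
  (S.mem_cent_iff).2 fun x _ => by
    have h1 := S.den_normal.conj_mem g hg x⁻¹
    have h2 := S.den.mul_mem h1 (S.den.inv_mem hg)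
    simpa [mul_assoc] using h2

/-- Central chief factors for a class are transported along isomorphisms of the factors which are
equivariant over a surjective homomorphism of groups. -/
theorem isCentralFor_congr {G' : Type u} [Group G'] (S : NormalSection G) (T : NormalSection G')
    (π : G →* G') (hπ : Function.Surjective π) (e : S.Factor ≃* T.Factor)
    (he : ∀ g x, e (S.conj g x) = T.conj (π g) (e x)) :
    S.IsCentralFor F ↔ T.IsCentralFor F := by
  let h : G →* G' ⧸ T.cent := (QuotientGroup.mk' T.cent).comp π
  have hh : Function.Surjective h := (QuotientGroup.mk'_surjective _).comp hπ
  have hker : S.cent = h.ker := by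
    rw [← MonoidHom.comap_ker, QuotientGroup.ker_mk']
    ext g
    rw [Subgroup.mem_comap, MonoidHom.mem_ker, MonoidHom.mem_ker]
    constructor
    · intro hg
      ext y
      obtain ⟨x, rfl⟩ := e.surjective y
      rw [← he, hg]
      rfl
    · intro hg
      ext x
      apply e.injective
      rw [he, hg]
      rfl
  let k : G ⧸ S.cent ≃* G' ⧸ T.cent :=
    (QuotientGroup.quotientMulEquivOfEq hker).trans
      (QuotientGroup.quotientKerEquivOfSurjective h hh)
  let E : S.Semidirect ≃* T.Semidirect := SemidirectProduct.congr e k (by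
    intro q
    induction q using QuotientGroup.induction_on with
    | H g =>
      ext x
      exact he g x)
  exact ⟨fun hS => hS.of_mulEquiv E, fun hT => hT.of_mulEquiv E.symm⟩

/-- The isomorphism of factors given by a homomorphism of the numerators which induces a bijection
modulo the denominators. -/
noncomputable def factorEquivOfHom {G' : Type u} [Group G'] (S : NormalSection G)
    (T : NormalSection G') (ψ : S.num →* T.num)
    (hker : ∀ x : S.num, (ψ x : G') ∈ T.den ↔ (x : G) ∈ S.den)
    (hsurj : ∀ y : T.num, ∃ x : S.num, (ψ x : G')⁻¹ * y ∈ T.den) : S.Factor ≃* T.Factor :=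
  (QuotientGroup.quotientMulEquivOfEq (by
      rw [← MonoidHom.comap_ker, QuotientGroup.ker_mk']
      ext x
      rw [Subgroup.mem_comap, Subgroup.mem_subgroupOf, Subgroup.mem_subgroupOf, hker])).trans
    (QuotientGroup.quotientKerEquivOfSurjective
      ((QuotientGroup.mk' (T.den.subgroupOf T.num)).comp ψ) (by
        intro y
        induction y using QuotientGroup.induction_on with
        | H y =>
          obtain ⟨x, hx⟩ := hsurj y
          exact ⟨x, QuotientGroup.eq.2 hx⟩))

theorem isCentralFor_congr_of_hom {G' : Type u} [Group G'] (S : NormalSection G)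
    (T : NormalSection G') (π : G →* G') (hπ : Function.Surjective π) (ψ : S.num →* T.num)
    (hequiv : ∀ g x, ψ (MulAut.conjNormal g x) = MulAut.conjNormal (π g) (ψ x))
    (hker : ∀ x : S.num, (ψ x : G') ∈ T.den ↔ (x : G) ∈ S.den)
    (hsurj : ∀ y : T.num, ∃ x : S.num, (ψ x : G')⁻¹ * y ∈ T.den) :
    S.IsCentralFor F ↔ T.IsCentralFor F := by
  refine isCentralFor_congr S T π hπ (factorEquivOfHom S T ψ hker hsurj) ?_
  intro g x
  induction x using QuotientGroup.induction_on with
  | H x => exact congrArg (fun y : T.num => (y : T.Factor)) (hequiv g x)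

/-- The preimage of a normal section under a homomorphism. -/
def comap {G' : Type u} [Group G'] (T : NormalSection G') (π : G →* G') : NormalSection G where
  num := T.num.comap π
  den := T.den.comap π
  num_normal := T.num_normal.comap π
  den_normal := T.den_normal.comap π
  den_le_num := Subgroup.comap_mono T.den_le_num

/-- The restriction of a homomorphism to the numerators of a section and its preimage. -/
def comapNum {G' : Type u} [Group G'] (T : NormalSection G') (π : G →* G') :
    (T.comap π).num →* T.num :=
  π.subgroupComap T.num

theorem exists_comapNum {G' : Type u} [Group G'] (T : NormalSection G') (π : G →* G')
    (hπ : Function.Surjective π) (y : T.num) :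
    ∃ x : (T.comap π).num, (T.comapNum π x : G')⁻¹ * y ∈ T.den := by
  obtain ⟨x, hx⟩ := hπ y
  refine ⟨⟨x, (hx ▸ y.2 : π x ∈ T.num)⟩, ?_⟩
  change (π x)⁻¹ * y ∈ T.den
  rw [hx, inv_mul_cancel]
  exact T.den.one_mem

/-- A section and its preimage under a surjective homomorphism have isomorphic factors. -/
noncomputable def comapFactorEquiv {G' : Type u} [Group G'] (T : NormalSection G') (π : G →* G')
    (hπ : Function.Surjective π) : (T.comap π).Factor ≃* T.Factor :=
  factorEquivOfHom _ _ (T.comapNum π) (fun _ => Iff.rfl) (T.exists_comapNum π hπ)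

theorem isCentralFor_comap {G' : Type u} [Group G'] (T : NormalSection G') (π : G →* G')
    (hπ : Function.Surjective π) : (T.comap π).IsCentralFor F ↔ T.IsCentralFor F := by
  refine isCentralFor_congr_of_hom (T.comap π) T π hπ (T.comapNum π) ?_ (fun _ => Iff.rfl)
    (T.exists_comapNum π hπ)
  intro g x
  ext
  exact (by simp : π (g * x * g⁻¹) = π g * π x * (π g)⁻¹)

theorem IsChief.comap {G' : Type u} [Group G'] {T : NormalSection G'} (hT : T.IsChief)
    (π : G →* G') (hπ : Function.Surjective π) : (T.comap π).IsChief := by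
  refine ⟨(Subgroup.comap_lt_comap_of_surjective hπ).2 hT.1, fun N hN h1 h2 => ?_⟩
  have hker : π.ker ≤ N := (Subgroup.ker_le_comap π T.den).trans h1
  have h3 := Subgroup.comap_map_eq_self hker
  have := hT.2 (N.map π) (hN.map π hπ)
    ((Subgroup.comap_le_comap_of_surjective hπ).1 (by rwa [h3]))
    ((Subgroup.comap_le_comap_of_surjective hπ).1 (by rwa [h3]))
  rw [← h3]
  exact this.imp (congrArg _) (congrArg _)

/-- The second isomorphism theorem for sections. -/
theorem isCentralFor_of_perspective (S T : NormalSection G) (h1 : S.num ⊓ T.den = S.den)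
    (h2 : S.num ⊔ T.den = T.num) : S.IsCentralFor F ↔ T.IsCentralFor F := by
  refine isCentralFor_congr_of_hom S T (MonoidHom.id G) Function.surjective_id
    (Subgroup.inclusion (le_sup_left.trans h2.le)) ?_ ?_ ?_
  · intro g x
    rfl
  · intro x
    rw [← h1]
    simp
  · intro y
    have hy : (y : G) ∈ S.num ⊔ T.den := h2.ge y.2
    obtain ⟨s, hs, t, ht, hst⟩ := Subgroup.mem_sup_of_normal_right.1 hy
    refine ⟨⟨s, hs⟩, ?_⟩
    rw [Subgroup.coe_inclusion, ← hst]
    simpa using ht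

/-- `G/C_G(H/K)` is a quotient of the semidirect product, so it lies in the formation as well. -/
theorem IsCentralFor.residual_le_cent [Finite G] (hF : F.IsFormation) {S : NormalSection G}
    (h : S.IsCentralFor F) : F.residual G ≤ S.cent := by
  have : Finite S.Semidirect := F.finite_of_mem _ h
  exact GroupClass.residual_le (GroupClass.Mem.of_surjective hF h SemidirectProduct.rightHom
    SemidirectProduct.rightHom_surjective)

instance finite_semidirect {N H : Type u} [Group N] [Group H] [Finite N] [Finite H]
    (φ : H →* MulAut N) : Finite (N ⋊[φ] H) :=
  Finite.of_equiv _ SemidirectProduct.equivProd.symm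

/-- In a group of the formation all normal sections are central for the formation. -/
theorem isCentralFor_of_mem [Finite G] (hF : F.IsFormation) (S : NormalSection G)
    (h : F.Mem (G ⧸ S.den)) : S.IsCentralFor F := by
  let toSemidirect : S.Factor ⋊[S.conj] G →* S.Semidirect :=
    SemidirectProduct.map (MonoidHom.id _) (QuotientGroup.mk' _) (fun g => rfl)
  have hsurj : Function.Surjective toSemidirect := by
    rintro ⟨n, q⟩
    obtain ⟨g, rfl⟩ := QuotientGroup.mk'_surjective _ q
    exact ⟨⟨n, g⟩, rfl⟩
  let ι : S.Factor →* G ⧸ S.den :=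
    QuotientGroup.map _ _ S.num.subtype (fun x hx => hx)
  have hι : ∀ x, ι x = 1 → x = 1 := by
    intro x
    induction x using QuotientGroup.induction_on with
    | H x =>
      intro hx
      have : (x : G) ∈ S.den := (QuotientGroup.eq_one_iff _).1 hx
      exact (QuotientGroup.eq_one_iff _).2 this
  -- Multiplication and projection are two homomorphisms onto `G ⧸ S.den`, which is in `F`, so the
  -- residual of the big semidirect product lies in both kernels. An element killed by both has
  -- trivial left component and right component in `S.den ≤ S.cent`, hence is killed by
  -- `toSemidirect`.
  let mult : S.Factor ⋊[S.conj] G →* G ⧸ S.den :=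
    SemidirectProduct.lift ι (QuotientGroup.mk' _) (by
      intro g
      ext x
      rfl)
  have hmult : Function.Surjective mult := by
    intro q
    obtain ⟨g, rfl⟩ := QuotientGroup.mk'_surjective _ q
    exact ⟨SemidirectProduct.inr g, SemidirectProduct.lift_inr _ _ _ _⟩
  have hright : Function.Surjective
      ((QuotientGroup.mk' S.den).comp (SemidirectProduct.rightHom (φ := S.conj))) :=
    (QuotientGroup.mk'_surjective _).comp SemidirectProduct.rightHom_surjective
  have h1 := (GroupClass.mem_iff_residual_le_ker hF mult hmult).1 h
  have h2 := (GroupClass.mem_iff_residual_le_ker hF _ hright).1 h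
  refine (GroupClass.mem_iff_residual_le_ker hF toSemidirect hsurj).2 fun x hx => ?_
  have hx1 : ι x.left * (x.right : G ⧸ S.den) = 1 := h1 hx
  have hx2 : (x.right : G ⧸ S.den) = 1 := h2 hx
  rw [hx2, mul_one] at hx1
  apply SemidirectProduct.ext
  · exact hι _ hx1
  · exact (QuotientGroup.eq_one_iff _).2 (S.den_le_cent ((QuotientGroup.eq_one_iff _).1 hx2))

end NormalSection

/-! ### Existence of chief factors; the lattice hypothesis in quotients. -/

theorem Group.isNilpotent_of_forall_mul_comm {G : Type u} [Group G]
    (h : ∀ a b : G, a * b = b * a) : Group.IsNilpotent G := by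
  let _ : CommGroup G := { ‹Group G› with mul_comm := h }
  exact CommGroup.isNilpotent

theorem Subgroup.normal_of_normalClosure_le_normalCore {G : Type u} [Group G] {A : Subgroup G}
    (h : Subgroup.normalClosure (A : Set G) ≤ A.normalCore) : A.Normal := by
  have : A = A.normalCore := le_antisymm (Subgroup.le_normalClosure.trans h) A.normalCore_le
  rw [this]
  infer_instance

namespace NormalSection

variable {F : GroupClass.{u}} {G : Type u} [Group G]

theorem exists_isChief_num_eq [Finite G] {K L : Subgroup G} (hK : K.Normal) (hL : L.Normal)
    (h : K < L) : ∃ S : NormalSection G, S.IsChief ∧ S.num = L ∧ K ≤ S.den := by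
  obtain ⟨M, hKM, hM⟩ := Set.Finite.exists_le_maximal
    (Set.toFinite {M : Subgroup G | M.Normal ∧ M < L}) ⟨hK, h⟩
  refine ⟨⟨L, M, hL, hM.prop.1, hM.prop.2.le⟩, ⟨hM.prop.2, fun N hN h1 h2 => ?_⟩, rfl, hKM⟩
  rcases h2.eq_or_lt with h3 | h3
  · exact Or.inr h3
  · exact Or.inl (le_antisymm (hM.le_of_ge ⟨hN, h3⟩ h1) h1)

theorem exists_isChief_den_eq [Finite G] {K L : Subgroup G} (hK : K.Normal) (hL : L.Normal)
    (h : K < L) : ∃ S : NormalSection G, S.IsChief ∧ S.den = K ∧ S.num ≤ L := by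
  obtain ⟨M, hML, hM⟩ := Set.Finite.exists_le_minimal
    (Set.toFinite {M : Subgroup G | M.Normal ∧ K < M}) ⟨hL, h⟩
  refine ⟨⟨M, K, hM.prop.1, hK, hM.prop.2.le⟩, ⟨hM.prop.2, fun N hN h1 h2 => ?_⟩, rfl, hML⟩
  rcases h1.eq_or_lt with h3 | h3
  · exact Or.inl h3.symm
  · exact Or.inr (le_antisymm h2 (hM.le_of_le ⟨hN, h3⟩ h2))

theorem closureModCore_comap {G' : Type u} [Group G'] (A : Subgroup G') (π : G →* G')
    (hπ : Function.Surjective π) :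
    closureModCore (A.comap π) = (closureModCore A).comap π := by
  have h1 : Subgroup.normalClosure (A.comap π : Set G) =
      (Subgroup.normalClosure (A : Set G')).comap π := by
    apply le_antisymm
    · have : ((Subgroup.normalClosure (A : Set G')).comap π).Normal :=
        Subgroup.normalClosure_normal.comap π
      exact Subgroup.normalClosure_le_normal (Subgroup.comap_mono Subgroup.le_normalClosure)
    · have hle : π.ker ≤ Subgroup.normalClosure (A.comap π : Set G) :=
        (Subgroup.ker_le_comap π A).trans Subgroup.le_normalClosure
      rw [← Subgroup.comap_map_eq_self hle, Subgroup.map_normalClosure _ _ hπ]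
      apply Subgroup.comap_mono
      rw [Subgroup.coe_comap, Set.image_preimage_eq _ hπ]
  have h2 : (A.comap π).normalCore = A.normalCore.comap π := by
    apply le_antisymm
    · have : ((A.comap π).normalCore.map π).Normal :=
        Subgroup.Normal.map inferInstance π hπ
      rw [← Subgroup.map_le_iff_le_comap, Subgroup.normal_le_normalCore,
        Subgroup.map_le_iff_le_comap]
      exact Subgroup.normalCore_le _
    · have : (A.normalCore.comap π).Normal := A.normalCore_normal.comap π
      rw [Subgroup.normal_le_normalCore]
      exact Subgroup.comap_mono (Subgroup.normalCore_le _)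
  unfold closureModCore comap
  congr

end NormalSection

open NormalSection

section Quotients

variable {F : GroupClass.{u}} {G : Type u} [Group G]

/-- Preimages commute with normal closure and normal core and preserve factors, chief factors and
`F`-centrality. This is what permits passing to quotients later. -/
theorem latticeOfClass_subset_of_surjective
    (hL : latticeOfClass F G ⊆ latticeOfSections (chiefFactorsCentralFor F G))
    {G' : Type u} [Group G'] (π : G →* G') (hπ : Function.Surjective π) :
    latticeOfClass F G' ⊆ latticeOfSections (chiefFactorsCentralFor F G') := by
  intro A hA T hT h1 h2
  refine ⟨hT, ?_⟩
  have hA' : A.comap π ∈ latticeOfClass F G := by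
    change F.Mem (closureModCore (A.comap π)).Factor
    rw [closureModCore_comap A π hπ]
    exact GroupClass.Mem.of_mulEquiv hA (comapFactorEquiv _ π hπ).symm
  have h3 := hL hA' (T.comap π) (hT.comap π hπ)
  rw [closureModCore_comap A π hπ] at h3
  exact (isCentralFor_comap T π hπ).1
    (h3 (Subgroup.comap_mono h1) (Subgroup.comap_mono h2)).2

/-- Core and closure of `A` lie between `S.den` and `S.num`, so each equals one of them. A
non-normal `A` has core `S.den` and closure `S.num`, and the lattice hypothesis would then make `S`
itself `F`-central. -/
theorem normal_of_mem_latticeOfClass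
    (hL : latticeOfClass F G ⊆ latticeOfSections (chiefFactorsCentralFor F G))
    {S : NormalSection G} (hS : S.IsChief) (hSF : ¬ S.IsCentralFor F) {A : Subgroup G}
    (hA : A ∈ latticeOfClass F G) (h1 : S.den ≤ A) (h2 : A ≤ S.num) : A.Normal := by
  apply Subgroup.normal_of_normalClosure_le_normalCore
  have h3 : S.den ≤ A.normalCore := Subgroup.normal_le_normalCore.2 h1
  have h4 : Subgroup.normalClosure (A : Set G) ≤ S.num := Subgroup.normalClosure_le_normal h2
  have h5 : A.normalCore ≤ Subgroup.normalClosure (A : Set G) :=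
    A.normalCore_le.trans Subgroup.le_normalClosure
  rcases hS.2 A.normalCore inferInstance h3 (h5.trans h4) with h6 | h6
  · rcases hS.2 (Subgroup.normalClosure (A : Set G)) inferInstance (h3.trans h5) h4 with h7 | h7
    · rw [h6, h7]
    · exact absurd (hL hA S hS h6.le h7.ge).2 hSF
  · rw [h6]
    exact h4

end Quotients

/-! ### Chief factors below a soluble residual, and its nilpotency. -/

namespace NormalSection

variable {F : GroupClass.{u}} {G : Type u} [Group G]

/-- By minimality the only alternative is `[H,H]K = H`, which makes `H/K` a nontrivial perfect
soluble group. -/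
theorem IsChief.commutator_le {S : NormalSection G} (hS : S.IsChief)
    (hsol : Group.IsSolvable S.num) : ⁅S.num, S.num⁆ ≤ S.den := by
  rcases hS.2 (⁅S.num, S.num⁆ ⊔ S.den) inferInstance le_sup_right
    (sup_le (Subgroup.commutator_le_left _ _) S.den_le_num) with h | h
  · exact le_sup_left.trans h.le
  · exfalso
    have hsol' : Group.IsSolvable S.Factor :=
      Group.isSolvable_of_surjective (QuotientGroup.mk'_surjective _)
    have hne : (⊤ : Subgroup S.Factor) ≠ ⊥ := by
      intro h1
      apply hS.1.not_ge
      intro x hx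
      have : ((⟨x, hx⟩ : S.num) : S.Factor) ∈ (⊥ : Subgroup S.Factor) := h1 ▸ Subgroup.mem_top _
      exact (QuotientGroup.eq_one_iff (N := S.den.subgroupOf S.num) ⟨x, hx⟩).1
        (Subgroup.mem_bot.1 this)
    refine (Group.IsSolvable.commutator_lt_of_ne_bot hne).not_ge ?_
    intro y _
    induction y using QuotientGroup.induction_on with
    | H x =>
      have hx : (x : G) ∈ ⁅S.num, S.num⁆ ⊔ S.den := h.ge x.2
      obtain ⟨c, hc, d, hd, hcd⟩ := Subgroup.mem_sup_of_normal_right.1 hx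
      rw [← Subgroup.map_subtype_commutator] at hc
      obtain ⟨c', hc', rfl⟩ := hc
      have : (x : S.Factor) = (c' : S.Factor) := by
        rw [eq_comm, QuotientGroup.eq, Subgroup.mem_subgroupOf]
        have hd' : ((c'⁻¹ * x : S.num) : G) = d := by
          change (c' : G)⁻¹ * x = d
          rw [← hcd]
          exact inv_mul_cancel_left _ _
        exact hd' ▸ hd
      rw [this]
      have h2 := Subgroup.mem_map_of_mem (QuotientGroup.mk' (S.den.subgroupOf S.num)) hc'
      rw [_root_.commutator_def, Subgroup.map_commutator] at h2
      exact Subgroup.commutator_mono le_top le_top h2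

theorem factor_mul_comm (S : NormalSection G) (h : ⁅S.num, S.num⁆ ≤ S.den) (a b : S.Factor) :
    a * b = b * a := by
  induction a using QuotientGroup.induction_on with
  | H a =>
    induction b using QuotientGroup.induction_on with
    | H b =>
      rw [← QuotientGroup.mk_mul, ← QuotientGroup.mk_mul, QuotientGroup.eq,
        Subgroup.mem_subgroupOf]
      have := h (Subgroup.commutator_mem_commutator (inv_mem b.2) (inv_mem a.2))
      rw [commutatorElement_def] at this
      simpa [mul_assoc] using this

/-- `G/C_G(H/K)` embeds in the automorphism group of a cyclic group, which is abelian; so the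
quotient is nilpotent and lies in `F`. -/
theorem residual_le_cent_of_isCyclic [Finite G]
    (hN : ∀ (N : Type u) [Group N] [Finite N], Group.IsNilpotent N → F.Mem N)
    (S : NormalSection G) (hc : IsCyclic S.Factor) : F.residual G ≤ S.cent := by
  apply GroupClass.residual_le
  apply hN
  apply Group.isNilpotent_of_forall_mul_comm
  intro a b
  apply QuotientGroup.kerLift_injective S.conj
  rw [map_mul, map_mul]
  apply (IsCyclic.mulAutMulEquiv S.Factor).injective
  rw [map_mul, map_mul, mul_comm]

/-- A chief factor below a soluble residual is cyclic or central for the class. -/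
theorem IsChief.isCyclic_or_isCentralFor [Finite G]
    (hN : ∀ (N : Type u) [Group N] [Finite N], Group.IsNilpotent N → F.Mem N)
    (hL : latticeOfClass F G ⊆ latticeOfSections (chiefFactorsCentralFor F G))
    {S : NormalSection G} (hS : S.IsChief) (hsol : Group.IsSolvable S.num) :
    IsCyclic S.Factor ∨ S.IsCentralFor F := by
  by_contra! hcon
  obtain ⟨hcyc, hSF⟩ := hcon
  apply hcyc
  obtain ⟨x, hx, hxd⟩ := SetLike.exists_of_lt hS.1
  have h1 : Subgroup.zpowers x ⊔ S.den ≤ S.num := sup_le (by simpa using hx) S.den_le_num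
  -- The closure lies in `S.num` and the core contains `S.den`, so closure modulo core is a section
  -- of the abelian group `S.Factor`.
  have hA : Subgroup.zpowers x ⊔ S.den ∈ latticeOfClass F G := by
    apply hN
    apply Group.isNilpotent_of_forall_mul_comm
    apply factor_mul_comm
    refine le_trans ?_ ((hS.commutator_le hsol).trans (Subgroup.normal_le_normalCore.2 le_sup_right))
    exact Subgroup.commutator_mono (Subgroup.normalClosure_le_normal h1)
      (Subgroup.normalClosure_le_normal h1)
  have hnorm := normal_of_mem_latticeOfClass hL hS hSF hA le_sup_right h1
  rcases hS.2 _ hnorm le_sup_right h1 with h2 | h2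
  · exact absurd (h2.le (Subgroup.mem_sup_left (Subgroup.mem_zpowers x))) hxd
  · refine ⟨((⟨x, hx⟩ : S.num) : S.Factor), fun y => ?_⟩
    induction y using QuotientGroup.induction_on with
    | H y =>
      have hy : (y : G) ∈ Subgroup.zpowers x ⊔ S.den := h2.ge y.2
      obtain ⟨c, ⟨k, rfl⟩, d, hd, hcd⟩ := Subgroup.mem_sup_of_normal_right.1 hy
      refine ⟨k, ?_⟩
      change (((⟨x, hx⟩ : S.num) ^ k : S.num) : S.Factor) = y
      rw [QuotientGroup.eq, Subgroup.mem_subgroupOf]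
      simpa [← hcd] using hd

theorem IsChief.residual_le_cent [Finite G] (hF : F.IsFormation)
    (hN : ∀ (N : Type u) [Group N] [Finite N], Group.IsNilpotent N → F.Mem N)
    (hL : latticeOfClass F G ⊆ latticeOfSections (chiefFactorsCentralFor F G))
    {S : NormalSection G} (hS : S.IsChief) (hsol : Group.IsSolvable S.num) :
    F.residual G ≤ S.cent :=
  (hS.isCyclic_or_isCentralFor hN hL hsol).elim (S.residual_le_cent_of_isCyclic hN)
    (fun h => h.residual_le_cent hF)

/-- A normal subgroup which centralizes all chief factors below it is nilpotent. -/
theorem isNilpotent_of_le_cent [Finite G] (N : Subgroup G) [hN : N.Normal]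
    (h : ∀ S : NormalSection G, S.IsChief → S.num ≤ N → N ≤ S.cent) : Group.IsNilpotent N := by
  rw [Subgroup.isNilpotent_iff_lowerCentralSeries]
  have hnormal : ∀ n, (N.lowerCentralSeries n).Normal := by
    intro n
    induction n with
    | zero => exact hN
    | succ n ih => exact Subgroup.commutator_normal _ _
  -- The lower central series of `N` stabilizes at some `L = [L,N]`. If `L ≠ 1`, a chief factor with
  -- numerator `L` is centralized by `N`, so `[L,N]` falls into its denominator.
  obtain ⟨n, hn⟩ := WellFoundedGT.monotone_chain_condition
    (α := (Subgroup G)ᵒᵈ) ⟨N.lowerCentralSeries, N.lowerCentralSeries_antitone⟩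
  refine ⟨n, ?_⟩
  by_contra hne
  obtain ⟨S, hS, hnum, -⟩ := exists_isChief_num_eq Subgroup.normal_bot (hnormal n)
    (bot_lt_iff_ne_bot.2 hne)
  have hle := N.lowerCentralSeries_le_self n
  have h1 : ⁅N.lowerCentralSeries n, N⁆ ≤ S.den := by
    rw [Subgroup.commutator_comm, Subgroup.commutator_le]
    intro g hg x hx
    have h2 := (S.mem_cent_iff).1 (h S hS (hnum.le.trans hle) hg) x (hnum ▸ hx)
    have h3 := S.den_normal.conj_mem _ h2 x
    rw [commutatorElement_def]
    simpa [mul_assoc] using h3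
  have h2 : N.lowerCentralSeries n = N.lowerCentralSeries (n + 1) := hn (n + 1) n.le_succ
  apply hS.1.not_ge
  rw [hnum, h2]
  exact h1

end NormalSection

theorem residual_isNilpotent {F : GroupClass.{u}} {G : Type u} [Group G] [Finite G]
    (hF : F.IsFormation)
    (hN : ∀ (N : Type u) [Group N] [Finite N], Group.IsNilpotent N → F.Mem N)
    (hsol : Group.IsSolvable (F.residual G))
    (hL : latticeOfClass F G ⊆ latticeOfSections (chiefFactorsCentralFor F G)) :
    Group.IsNilpotent (F.residual G) :=
  isNilpotent_of_le_cent _ fun _ hS hle => hS.residual_le_cent hF hN hL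
    (Group.isSolvable_of_isSolvable_injective (Subgroup.inclusion_injective hle))

/-- If the normal closure of a subgroup is nilpotent, then the subgroup lies in the lattice of
the class. -/
theorem mem_latticeOfClass_of_le {F : GroupClass.{u}} {G : Type u} [Group G] [Finite G]
    (hN : ∀ (N : Type u) [Group N] [Finite N], Group.IsNilpotent N → F.Mem N)
    {D : Subgroup G} [D.Normal] (hD : Group.IsNilpotent D) {A : Subgroup G} (hA : A ≤ D) :
    A ∈ latticeOfClass F G := by
  have hle : Subgroup.normalClosure (A : Set G) ≤ D := Subgroup.normalClosure_le_normal hA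
  apply hN
  have h1 : Group.IsNilpotent (Subgroup.normalClosure (A : Set G)) :=
    Group.nilpotent_of_mulEquiv (Subgroup.subgroupOfEquivOfLe hle)
  have h2 : Group.IsNilpotent (closureModCore A).num := h1
  exact Group.nilpotent_of_surjective (QuotientGroup.mk' _) (QuotientGroup.mk'_surjective
    ((closureModCore A).den.subgroupOf (closureModCore A).num))

/-! ### No chief factor below the residual is `F`-central. -/

theorem Subgroup.isComplement'_of_inf_eq_bot_of_sup_eq_top {G : Type*} [Group G]
    {N H : Subgroup G} [N.Normal] (h1 : N ⊓ H = ⊥) (h2 : N ⊔ H = ⊤) : N.IsComplement' H := by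
  apply Subgroup.isComplement'_of_disjoint_and_mul_eq_univ (disjoint_iff.2 h1)
  rw [← Subgroup.normal_mul, h2, Subgroup.coe_top]

theorem exists_isCoatom_not_le {G : Type*} [Group G] {N : Subgroup G} (h : ¬ N ≤ frattini G) :
    ∃ M : Subgroup G, IsCoatom M ∧ ¬ N ≤ M := by
  by_contra! hcon
  exact h (le_iInf₂ fun M hM => hcon M hM)

namespace NormalSection

variable {F : GroupClass.{u}} {G : Type u} [Group G]

theorem IsChief.of_comap {G' : Type u} [Group G'] {T : NormalSection G'} {π : G →* G'}
    (hπ : Function.Surjective π) (hT : (T.comap π).IsChief) : T.IsChief := by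
  refine ⟨(Subgroup.comap_lt_comap_of_surjective hπ).1 hT.1, fun N hN h1 h2 => ?_⟩
  exact (hT.2 (N.comap π) (hN.comap π) (Subgroup.comap_mono h1) (Subgroup.comap_mono h2)).imp
    (fun h => Subgroup.comap_injective hπ h) (fun h => Subgroup.comap_injective hπ h)

theorem IsChief.of_perspective {S T : NormalSection G} (h1 : S.num ⊓ T.den = S.den)
    (h2 : S.num ⊔ T.den = T.num) (hS : S.IsChief) : T.IsChief := by
  refine ⟨T.den_le_num.lt_of_ne fun h => ?_, fun N hN hN1 hN2 => ?_⟩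
  · apply hS.1.ne
    rw [← h1, inf_eq_left, h]
    exact le_sup_left.trans h2.le
  · rcases hS.2 (S.num ⊓ N) inferInstance (h1 ▸ inf_le_inf_left _ hN1) inf_le_left with h | h
    · left
      refine le_antisymm (fun n hn => ?_) hN1
      obtain ⟨s, hs, t, ht, rfl⟩ := Subgroup.mem_sup_of_normal_right.1 (h2.ge (hN2 hn))
      have hsN : s ∈ N := (N.mul_mem_cancel_right (hN1 ht)).1 hn
      have hsd : s ∈ S.den := h.le ⟨hs, hsN⟩
      exact T.den.mul_mem (h1.ge hsd).2 ht
    · right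
      exact le_antisymm hN2 (h2 ▸ sup_le (inf_eq_left.1 h) hN1)

/-- The residual for a saturated formation is not a minimal normal subgroup which is central for
the formation. -/
theorem IsChief.num_ne_residual [Finite G] (hF : F.IsFormation) (hsat : F.IsSaturated)
    {S : NormalSection G} (hS : S.IsChief) (hden : S.den = ⊥) (hSF : S.IsCentralFor F) :
    S.num ≠ F.residual G := by
  intro hR
  have hbot : F.residual G ≠ ⊥ := by
    rw [← hR, ← hden]
    exact hS.1.ne'
  -- The residual centralizes every `F`-central section, here itself, so it is abelian.
  have hcomm : ∀ x ∈ S.num, ∀ y ∈ S.num, x * y * x⁻¹ = y := by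
    intro x hx y hy
    have h1 := (S.mem_cent_iff).1 (hSF.residual_le_cent hF (hR ▸ hx)) y hy
    rw [hden, Subgroup.mem_bot, inv_mul_eq_one] at h1
    exact h1.symm
  have hfrat : ¬ F.residual G ≤ frattini G := fun h =>
    hbot ((GroupClass.mem_iff_residual_eq_bot hF).1 (hsat G h))
  obtain ⟨M, hM, hRM⟩ := exists_isCoatom_not_le hfrat
  rw [← hR] at hRM
  have hsup : S.num ⊔ M = ⊤ := hM.2 _ (lt_of_le_of_ne le_sup_right fun h =>
    hRM (h ▸ le_sup_left))
  -- `M` normalizes the intersection and the abelian `S.num` centralizes it, while together they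
  -- generate `G`. Minimality then makes `M` a complement.
  have hnorm : (S.num ⊓ M).Normal := by
    refine ⟨fun n hn g => ?_⟩
    obtain ⟨r, hr, m, hm, rfl⟩ := Subgroup.mem_sup_of_normal_left.1 (hsup ▸ Subgroup.mem_top g)
    have h1 : m * n * m⁻¹ ∈ S.num ⊓ M :=
      ⟨S.num_normal.conj_mem n hn.1 m, M.mul_mem (M.mul_mem hm hn.2) (M.inv_mem hm)⟩
    have h2 : r * m * n * (r * m)⁻¹ = r * (m * n * m⁻¹) * r⁻¹ := by group
    rw [h2, hcomm r hr _ h1.1]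
    exact h1
  have hinf : S.num ⊓ M = ⊥ := by
    rcases hS.2 _ hnorm (hden ▸ bot_le) inf_le_left with h | h
    · rw [h, hden]
    · exact absurd (inf_eq_left.1 h) hRM
  let e := SemidirectProduct.mulEquivSubgroup
    (Subgroup.isComplement'_of_inf_eq_bot_of_sup_eq_top hinf hsup)
  have hMn : M ≤ Subgroup.normalizer (S.num : Set G) :=
    le_top.trans (Subgroup.normalizer_eq_top_iff.2 S.num_normal).ge
  let f : S.num ⋊[S.num.normalizerMonoidHom.comp (Subgroup.inclusion hMn)] M →* S.Semidirect :=
    SemidirectProduct.map (QuotientGroup.mk' _) ((QuotientGroup.mk' S.cent).comp M.subtype)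
      (fun m => rfl)
  have hf : Function.Surjective f := by
    rintro ⟨n, q⟩
    obtain ⟨g, rfl⟩ := QuotientGroup.mk'_surjective _ q
    obtain ⟨n, rfl⟩ := QuotientGroup.mk'_surjective _ n
    obtain ⟨r, hr, m, hm, rfl⟩ := Subgroup.mem_sup_of_normal_left.1 (hsup ▸ Subgroup.mem_top g)
    refine ⟨⟨n, ⟨m, hm⟩⟩, SemidirectProduct.ext rfl ?_⟩
    have hr' : r ∈ S.cent := hSF.residual_le_cent hF (hR ▸ hr)
    change (m : G ⧸ S.cent) = ((r * m : G) : G ⧸ S.cent)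
    rw [QuotientGroup.mk_mul, (QuotientGroup.eq_one_iff r).2 hr', one_mul]
  -- `G = S.num ⋊ M` maps onto the semidirect product in `F`, so the residual is killed; but this
  -- map is injective on `S.num`, which is the residual.
  have hle := (GroupClass.mem_iff_residual_le_ker hF (f.comp e.symm.toMonoidHom)
    (hf.comp e.symm.surjective)).1 hSF
  apply hbot
  rw [eq_bot_iff]
  intro r hr
  have h1 : f (e.symm r) = 1 := hle hr
  rw [← hR] at hr
  have h2 : e.symm r = SemidirectProduct.inl ⟨r, hr⟩ := by
    rw [MulEquiv.symm_apply_eq]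
    change r = (r : G) * 1
    rw [mul_one]
  rw [h2] at h1
  have h3 : ((⟨r, hr⟩ : S.num) : S.Factor) = 1 := congrArg SemidirectProduct.left h1
  exact hden ▸ (QuotientGroup.eq_one_iff (N := S.den.subgroupOf S.num) ⟨r, hr⟩).1 h3

end NormalSection

open NormalSection

variable {F : GroupClass.{u}} {G : Type u} [Group G]

/-- If all chief factors `H / K` below the residual with `K ≠ 1` fail to be central for the class,
then so do the minimal normal subgroups below the residual. -/
theorem not_isCentralFor_of_den_eq_bot [Finite G] (hF : F.IsFormation) (hsat : F.IsSaturated)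
    (hN : ∀ (N : Type u) [Group N] [Finite N], Group.IsNilpotent N → F.Mem N)
    (hsol : Group.IsSolvable (F.residual G))
    (hL : latticeOfClass F G ⊆ latticeOfSections (chiefFactorsCentralFor F G))
    (hmin : ∀ T : NormalSection G, T.IsChief → T.num ≤ F.residual G → T.den ≠ ⊥ →
      ¬ T.IsCentralFor F)
    {R : NormalSection G} (hR : R.IsChief) (hden : R.den = ⊥) (hle : R.num ≤ F.residual G) :
    ¬ R.IsCentralFor F := by
  intro hRF
  have hRbot : R.num ≠ ⊥ := hden ▸ hR.1.ne'
  -- Otherwise `RN/N` is `G`-isomorphic to `R`, an `F`-central chief factor with nontrivial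
  -- denominator.
  have hleast : ∀ N : Subgroup G, N.Normal → N ≠ ⊥ → N ≤ F.residual G → R.num ≤ N := by
    intro N hNn hNbot hNle
    by_contra hRN
    have hinf : R.num ⊓ N = ⊥ := by
      rcases hR.2 (R.num ⊓ N) inferInstance (hden ▸ bot_le) inf_le_left with h | h
      · rw [h, hden]
      · exact absurd (inf_eq_left.1 h) hRN
    let T : NormalSection G := ⟨R.num ⊔ N, N, inferInstance, hNn, le_sup_right⟩
    have h1 : R.num ⊓ T.den = R.den := hinf.trans hden.symm
    exact hmin T (hR.of_perspective h1 rfl) (sup_le hle hNle) hNbot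
      ((isCentralFor_of_perspective R T h1 rfl).1 hRF)
  have hnilp := residual_isNilpotent hF hN hsol hL
  -- For non-normal `A` a chief factor at the top of `A^G/A_G` is `F`-central, so its denominator is
  -- trivial. Then `A^G` is minimal normal and contains `R`, so it equals `R`.
  have hnormal : ∀ A : Subgroup G, A ≤ F.residual G → A.Normal ∨ A ≤ R.num := by
    intro A hA
    by_cases h : Subgroup.normalClosure (A : Set G) ≤ A.normalCore
    · exact Or.inl (Subgroup.normal_of_normalClosure_le_normalCore h)
    · right
      have hAL := mem_latticeOfClass_of_le hN hnilp hA
      have hcl : Subgroup.normalClosure (A : Set G) ≤ F.residual G :=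
        Subgroup.normalClosure_le_normal hA
      have hlt : A.normalCore < Subgroup.normalClosure (A : Set G) :=
        lt_of_le_not_ge (A.normalCore_le.trans Subgroup.le_normalClosure) h
      obtain ⟨T, hT, hTnum, hTden⟩ := exists_isChief_num_eq inferInstance
        Subgroup.normalClosure_normal hlt
      have hTbot : T.den = ⊥ := by
        by_contra hne
        exact hmin T hT (hTnum ▸ hcl) hne (hL hAL T hT hTden hTnum.le).2
      have hRT : R.num ≤ T.num := hleast T.num T.num_normal
        (hTbot ▸ hT.1.ne') (hTnum ▸ hcl)
      rcases hT.2 R.num R.num_normal (hTbot ▸ bot_le) hRT with h1 | h1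
      · exact absurd (h1.trans hTbot) hRbot
      · rw [h1, hTnum]
        exact Subgroup.le_normalClosure
  have hlt : R.num < F.residual G :=
    lt_of_le_of_ne hle (hR.num_ne_residual hF hsat hden hRF)
  obtain ⟨S, hS, hSden, hSnum⟩ := exists_isChief_den_eq R.num_normal inferInstance hlt
  obtain ⟨x, hx, hxR⟩ := SetLike.exists_of_lt hS.1
  rw [hSden] at hxR
  have hxS : Subgroup.zpowers x ≤ S.num := by simpa using hx
  have hxnormal : (Subgroup.zpowers x).Normal := (hnormal _ (hxS.trans hSnum)).resolve_right
    (fun h => hxR (h (Subgroup.mem_zpowers x)))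
  have hxbot : Subgroup.zpowers x ≠ ⊥ := by
    rw [Ne, Subgroup.zpowers_eq_bot]
    rintro rfl
    exact hxR R.num.one_mem
  have hSx : Subgroup.zpowers x = S.num := by
    refine (hS.2 _ hxnormal ?_ hxS).resolve_left
      (fun h => hxR (hSden ▸ h ▸ Subgroup.mem_zpowers x))
    rw [hSden]
    exact hleast _ hxnormal hxbot (hxS.trans hSnum)
  have hcomm : ∀ a b : S.num, Commute a b := by
    rintro ⟨a, ha⟩ ⟨b, hb⟩
    rw [← hSx] at ha hb
    obtain ⟨i, rfl⟩ := ha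
    obtain ⟨j, rfl⟩ := hb
    exact Subtype.ext (((Commute.refl x).zpow_zpow i j).eq)
  -- `S.num = ⟨x⟩` is cyclic, and taking powers with exponent `|R|` is a `G`-endomorphism of it. Its
  -- kernel and its image both turn out to be `R`, so it induces a `G`-isomorphism from `S/R` to
  -- `R`.
  let p := Nat.card R.num
  let φ : S.num →* S.num := MonoidHom.mk' (fun a => a ^ p) (fun a b => (hcomm a b).mul_pow p)
  have hφconj : ∀ (g : G) (a : S.num), φ (MulAut.conjNormal g a) = MulAut.conjNormal g (φ a) :=
    fun g a => (map_pow (MulAut.conjNormal g : MulAut S.num) a p).symm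
  have hker : φ.ker.map S.num.subtype = R.num := by
    rw [← hSden]
    refine (hS.2 (φ.ker.map S.num.subtype) ⟨?_⟩ ?_ (Subgroup.map_subtype_le _)).resolve_right ?_
    · rintro _ ⟨a, ha, rfl⟩ g
      refine ⟨MulAut.conjNormal g a, ?_, rfl⟩
      change φ _ = 1
      rw [hφconj, (ha : φ a = 1), map_one]
    · intro r hr
      refine ⟨⟨r, S.den_le_num hr⟩, ?_, rfl⟩
      rw [hSden] at hr
      have : r ^ p = 1 := by
        have := pow_card_eq_one' (x := (⟨r, hr⟩ : R.num))
        exact congrArg Subtype.val this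
      exact Subtype.ext this
    · intro h
      obtain ⟨a, ha, hax⟩ := h.ge hx
      have h1 : x ^ p = 1 := by
        rw [← hax]
        exact congrArg Subtype.val ha
      have h2 : Nat.card S.num ≤ Nat.card R.num := by
        rw [← hSx, Nat.card_zpowers]
        exact Nat.le_of_dvd Nat.card_pos (orderOf_dvd_of_pow_eq_one h1)
      exact hS.1.ne (Subgroup.eq_of_le_of_card_ge S.den_le_num (hSden ▸ h2))
  have hrange : φ.range.map S.num.subtype = R.num := by
    have hn : (φ.range.map S.num.subtype).Normal := by
      refine ⟨?_⟩
      rintro _ ⟨_, ⟨a, rfl⟩, rfl⟩ g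
      exact ⟨_, ⟨MulAut.conjNormal g a, rfl⟩, congrArg Subtype.val (hφconj g a)⟩
    have hne : φ.range.map S.num.subtype ≠ ⊥ := by
      intro h
      apply hS.1.ne'
      apply le_antisymm _ S.den_le_num
      rw [hSden, ← hker]
      intro y hy
      refine ⟨⟨y, hy⟩, Subtype.ext ?_, rfl⟩
      exact h.le ⟨_, ⟨⟨y, hy⟩, rfl⟩, rfl⟩
    rw [← hSden]
    refine (hS.2 _ hn ?_ (Subgroup.map_subtype_le _)).resolve_right ?_
    · rw [hSden]
      exact hleast _ hn hne ((Subgroup.map_subtype_le _).trans hSnum)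
    -- A surjective endomorphism of a finite group is injective, but the kernel is `R ≠ 1`.
    · intro h
      apply hRbot
      rw [← hker, (Subgroup.map_eq_bot_iff_of_injective _ S.num.subtype_injective)]
      apply (MonoidHom.ker_eq_bot_iff φ).2
      apply Finite.injective_iff_surjective.2
      intro y
      obtain ⟨z, ⟨a, ha⟩, hz⟩ := h.ge y.2
      exact ⟨a, ha.trans (Subtype.ext hz)⟩
  let ψ : S.num →* R.num := (S.num.subtype.comp φ).codRestrict R.num
    (fun a => hrange.le ⟨_, ⟨a, rfl⟩, rfl⟩)
  refine hmin S hS hSnum (hSden ▸ hRbot) ((isCentralFor_congr_of_hom S R (MonoidHom.id G)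
    Function.surjective_id ψ ?_ ?_ ?_).2 hRF)
  · intro g a
    exact Subtype.ext (congrArg Subtype.val (hφconj g a) :)
  · intro a
    rw [hden, Subgroup.mem_bot,
      show (a : G) ∈ S.den ↔ (a : G) ∈ φ.ker.map S.num.subtype by rw [hker, hSden]]
    constructor
    · intro h
      exact ⟨a, Subtype.ext h, rfl⟩
    · rintro ⟨b, hb, hba⟩
      rw [← Subtype.ext hba]
      exact congrArg Subtype.val hb
  · intro y
    obtain ⟨_, ⟨a, rfl⟩, ha⟩ := hrange.ge y.2
    refine ⟨a, ?_⟩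
    have h1 : (ψ a : G) = y := ha
    rw [h1, inv_mul_cancel]
    exact R.den.one_mem

/-- Under the hypothesis on the lattices no chief factor below the residual is central for the
formation. -/
theorem not_isCentralFor_of_num_le_residual [Finite G] (hF : F.IsFormation)
    (hsat : F.IsSaturated)
    (hN : ∀ (N : Type u) [Group N] [Finite N], Group.IsNilpotent N → F.Mem N)
    (hsol : Group.IsSolvable (F.residual G))
    (hL : latticeOfClass F G ⊆ latticeOfSections (chiefFactorsCentralFor F G))
    {S : NormalSection G} (hS : S.IsChief) (hle : S.num ≤ F.residual G) :
    ¬ S.IsCentralFor F := by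
  intro hSF
  -- With the denominator maximal among `F`-central chief factors below the residual, the quotient
  -- by it satisfies the minimality hypothesis of `not_isCentralFor_of_den_eq_bot`.
  obtain ⟨K, -, hK⟩ := Set.Finite.exists_le_maximal
    (Set.toFinite {K : Subgroup G | ∃ S : NormalSection G, S.IsChief ∧ S.num ≤ F.residual G ∧
      S.IsCentralFor F ∧ S.den = K}) ⟨S, hS, hle, hSF, rfl⟩
  obtain ⟨T, hT, hTle, hTF, rfl⟩ := hK.prop
  let π := QuotientGroup.mk' T.den
  have hπ : Function.Surjective π := QuotientGroup.mk'_surjective _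
  have hπker : π.ker = T.den := QuotientGroup.ker_mk' _
  have hres : (F.residual G).map π = F.residual (G ⧸ T.den) := GroupClass.map_residual hF π hπ
  let R : NormalSection (G ⧸ T.den) :=
    ⟨T.num.map π, ⊥, T.num_normal.map π hπ, inferInstance, bot_le⟩
  have hRT : R.comap π = T := by
    have h1 : (T.num.map π).comap π = T.num :=
      Subgroup.comap_map_eq_self (hπker.le.trans T.den_le_num)
    have h2 : (⊥ : Subgroup (G ⧸ T.den)).comap π = T.den := by
      rw [MonoidHom.comap_bot, hπker]
    unfold NormalSection.comap
    congr
  have hsol' : Group.IsSolvable (F.residual (G ⧸ T.den)) := by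
    rw [← hres]
    exact Group.isSolvable_of_surjective (MonoidHom.subgroupMap_surjective π (F.residual G))
  refine not_isCentralFor_of_den_eq_bot hF hsat hN hsol'
    (latticeOfClass_subset_of_surjective hL π hπ) (fun U hU hUle hUden hUF => ?_)
    (IsChief.of_comap hπ (hRT.symm ▸ hT) : R.IsChief) rfl
    (hres ▸ Subgroup.map_mono hTle) ((isCentralFor_comap R π hπ).1 (hRT.symm ▸ hTF))
  have hlt : T.den < (U.comap π).den := by
    have h1 : (⊥ : Subgroup (G ⧸ T.den)).comap π < U.den.comap π :=
      (Subgroup.comap_lt_comap_of_surjective hπ).2 (bot_lt_iff_ne_bot.2 hUden)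
    rwa [MonoidHom.comap_bot, hπker] at h1
  refine hlt.not_ge (hK.le_of_ge ⟨U.comap π, hU.comap π hπ, ?_,
    (isCentralFor_comap U π hπ).2 hUF, rfl⟩ hlt.le)
  have h1 : U.num.comap π ≤ ((F.residual G).map π).comap π :=
    Subgroup.comap_mono (hres ▸ hUle)
  rwa [Subgroup.comap_map_eq_self
    (hπker.le.trans (T.den_le_num.trans hTle))] at h1

/-! ### Structure of the residual: normal subgroups, commutativity, odd order, Hall property. -/

/-- Take `W` maximal with index divisible by `p`. If the index is `p * m` with `m ≠ 1`, an element
of prime order `q ∣ m` in `V ⧸ W` enlarges `W` and only divides the index by `q`. -/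
theorem exists_subgroup_index_eq_of_dvd {V : Type*} [CommGroup V] [Finite V] {p : ℕ}
    (h : p ∣ Nat.card V) : ∃ W : Subgroup V, W.index = p := by
  obtain ⟨W, -, hW⟩ := Set.Finite.exists_le_maximal
    (Set.toFinite {W : Subgroup V | p ∣ W.index}) (a := ⊥) (by simpa using h)
  refine ⟨W, ?_⟩
  obtain ⟨m, hm⟩ := hW.prop
  by_contra hne
  obtain ⟨q, hq, hqm⟩ := Nat.exists_prime_and_dvd (n := m)
    (by rintro rfl; exact hne (by simpa using hm))
  obtain ⟨k, rfl⟩ := hqm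
  have := Fact.mk hq
  have hcard : Nat.card (V ⧸ W) = p * (q * k) := by rw [← Subgroup.index_eq_card, hm]
  obtain ⟨y, hy⟩ := exists_prime_orderOf_dvd_card' (G := V ⧸ W) q
    (hcard ▸ Dvd.intro (p * k) (by ring))
  have h1 := Subgroup.card_mul_index (Subgroup.zpowers y)
  rw [Nat.card_zpowers, hy, hcard, show p * (q * k) = q * (p * k) by ring] at h1
  have h2 : (Subgroup.zpowers y).index = p * k := Nat.eq_of_mul_eq_mul_left hq.pos h1
  have hle : W ≤ (Subgroup.zpowers y).comap (QuotientGroup.mk' W) := by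
    have := Subgroup.ker_le_comap (QuotientGroup.mk' W) (Subgroup.zpowers y)
    rwa [QuotientGroup.ker_mk'] at this
  have h3 := hW.le_of_ge (y := (Subgroup.zpowers y).comap (QuotientGroup.mk' W)) (by
    change p ∣ _
    rw [Subgroup.index_comap_of_surjective _ (QuotientGroup.mk'_surjective W), h2]
    exact dvd_mul_right _ _) hle
  obtain ⟨v, rfl⟩ := QuotientGroup.mk'_surjective W y
  have h4 : v ∈ W := h3 (Subgroup.mem_zpowers (QuotientGroup.mk' W v))
  have h5 : QuotientGroup.mk' W v = 1 := (QuotientGroup.eq_one_iff v).2 h4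
  rw [h5, orderOf_one] at hy
  exact hq.one_lt.ne hy

theorem Subgroup.eq_bot_or_eq_of_le_of_card_prime {G : Type*} [Group G] {D : Subgroup G}
    (hD : (Nat.card D).Prime) {N : Subgroup G} (h : N ≤ D) : N = ⊥ ∨ N = D := by
  have : Finite D := Nat.finite_of_card_ne_zero hD.ne_zero
  rcases (Nat.dvd_prime hD).1 (Subgroup.card_dvd_of_le h) with h1 | h1
  · exact Or.inl (Subgroup.card_eq_one.1 h1)
  · exact Or.inr (Subgroup.eq_of_le_of_card_ge h h1.ge)

/-- Elements of order prime to `p - 1` centralize all normal subgroups of prime order `p`. -/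
theorem Subgroup.conj_eq_of_card_prime {G : Type*} [Group G] {D : Subgroup G} [D.Normal]
    (hD : (Nat.card D).Prime) {g : G} {k : ℕ} (hg : g ^ k = 1)
    (hk : k.Coprime (Nat.card D - 1)) {d : G} (hd : d ∈ D) : g * d * g⁻¹ = d := by
  have : Finite D := Nat.finite_of_card_ne_zero hD.ne_zero
  have := Fact.mk hD
  have : IsCyclic D := isCyclic_of_prime_card rfl
  -- The automorphism group of a cyclic group of prime order `p` has order `p - 1`, so the order of
  -- the induced automorphism divides two coprime numbers.
  have h1 : (MulAut.conjNormal g : MulAut D) ^ k = 1 := by rw [← map_pow, hg, map_one]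
  have h2 : (MulAut.conjNormal g : MulAut D) ^ (Nat.card D - 1) = 1 := by
    rw [← Nat.totient_prime hD, ← IsCyclic.card_mulAut, pow_card_eq_one']
  have h3 : (MulAut.conjNormal g : MulAut D) = 1 := by
    rw [← orderOf_eq_one_iff]
    exact Nat.eq_one_of_dvd_coprimes hk (orderOf_dvd_of_pow_eq_one h1)
      (orderOf_dvd_of_pow_eq_one h2)
  have h4 := congrArg Subtype.val (DFunLike.congr_fun h3 ⟨d, hd⟩)
  rwa [MulAut.conjNormal_apply] at h4

theorem isPowerAutomorphism_of_mem {H : Type u} [Group H] [Finite H] {α : MulAut H}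
    (h : ∀ K : Subgroup H, ∀ x ∈ K, α x ∈ K) : IsPowerAutomorphism α := by
  intro K
  apply Subgroup.eq_of_le_of_card_ge
  · rintro _ ⟨x, hx, rfl⟩
    exact h K x hx
  · exact (Nat.card_congr (K.equivMapOfInjective α.toMonoidHom α.injective).toEquiv).le

theorem NormalSection.isChief_of_card_prime {S : NormalSection G} (hden : S.den = ⊥)
    (h : (Nat.card S.num).Prime) : S.IsChief := by
  refine ⟨?_, fun N _ _ h2 => hden ▸ Subgroup.eq_bot_or_eq_of_le_of_card_prime h h2⟩
  rw [hden, bot_lt_iff_ne_bot]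
  intro h1
  rw [h1, Subgroup.card_bot] at h
  exact Nat.not_prime_one h

/-- The acting group is trivial, so the semidirect product is just the abelian factor. -/
theorem NormalSection.isCentralFor_of_cent_eq_top [Finite G]
    (hN : ∀ (N : Type u) [Group N] [Finite N], Group.IsNilpotent N → F.Mem N)
    {S : NormalSection G} (h : S.cent = ⊤) (hle : ⁅S.num, S.num⁆ ≤ S.den) :
    S.IsCentralFor F := by
  apply hN
  apply Group.isNilpotent_of_forall_mul_comm
  have hone : ∀ q : G ⧸ S.cent, q = 1 := by
    intro q
    induction q using QuotientGroup.induction_on with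
    | H g => exact (QuotientGroup.eq_one_iff g).2 (h ▸ Subgroup.mem_top g)
  intro a b
  apply SemidirectProduct.ext
  · rw [SemidirectProduct.mul_left, SemidirectProduct.mul_left, hone a.right, hone b.right,
      map_one, MulAut.one_apply, MulAut.one_apply]
    exact S.factor_mul_comm hle _ _
  · rw [hone (a * b).right, hone (b * a).right]

/-- If no chief factor below the nilpotent residual is central for the class, then all
subgroups of the residual are normal in the whole group. -/
theorem normal_of_le_residual [Finite G]
    (hN : ∀ (N : Type u) [Group N] [Finite N], Group.IsNilpotent N → F.Mem N)
    (hnilp : Group.IsNilpotent (F.residual G))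
    (hL : latticeOfClass F G ⊆ latticeOfSections (chiefFactorsCentralFor F G))
    (hnc : ∀ S : NormalSection G, S.IsChief → S.num ≤ F.residual G → ¬ S.IsCentralFor F)
    {A : Subgroup G} (hA : A ≤ F.residual G) : A.Normal := by
  by_contra h
  have hlt : A.normalCore < Subgroup.normalClosure (A : Set G) :=
    lt_of_le_not_ge (A.normalCore_le.trans Subgroup.le_normalClosure)
      fun h1 => h (Subgroup.normal_of_normalClosure_le_normalCore h1)
  -- A chief factor between core and closure of a non-normal `A` would be `F`-central, as `A` lies
  -- in `latticeOfClass` by nilpotency of the residual.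
  obtain ⟨T, hT, hTnum, hTden⟩ := exists_isChief_num_eq inferInstance
    Subgroup.normalClosure_normal hlt
  exact hnc T hT (hTnum.le.trans (Subgroup.normalClosure_le_normal hA))
    (hL (mem_latticeOfClass_of_le hN hnilp hA) T hT hTden hTnum.le).2

/-- The subgroup `⟨y⟩` is normal and cyclic, so the residual centralizes it. -/
theorem residual_commute [Finite G]
    (hN : ∀ (N : Type u) [Group N] [Finite N], Group.IsNilpotent N → F.Mem N)
    (hnormal : ∀ A : Subgroup G, A ≤ F.residual G → A.Normal) {x y : G}
    (hx : x ∈ F.residual G) (hy : y ∈ F.residual G) : x * y = y * x := by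
  let S : NormalSection G := ⟨Subgroup.zpowers y, ⊥,
    hnormal _ (Subgroup.zpowers_le.2 hy), inferInstance, bot_le⟩
  have hc : IsCyclic S.num := inferInstanceAs (IsCyclic (Subgroup.zpowers y))
  have hS : IsCyclic S.Factor :=
    isCyclic_of_surjective _ (QuotientGroup.mk'_surjective (S.den.subgroupOf S.num))
  have h1 := (S.mem_cent_iff).1 (S.residual_le_cent_of_isCyclic hN hS hx) y
    (Subgroup.mem_zpowers y)
  rw [Subgroup.mem_bot, inv_mul_eq_one, eq_mul_inv_iff_mul_eq] at h1
  exact h1.symm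

/-- A subgroup of order 2 in the residual is normal, hence central in `G`, and so is an `F`-central
chief factor. -/
theorem odd_card_residual [Finite G]
    (hN : ∀ (N : Type u) [Group N] [Finite N], Group.IsNilpotent N → F.Mem N)
    (hnormal : ∀ A : Subgroup G, A ≤ F.residual G → A.Normal)
    (hnc : ∀ S : NormalSection G, S.IsChief → S.num ≤ F.residual G → ¬ S.IsCentralFor F) :
    Odd (Nat.card (F.residual G)) := by
  rw [← Nat.not_even_iff_odd]
  intro heven
  obtain ⟨x, hx⟩ := exists_prime_orderOf_dvd_card' (G := F.residual G) 2 heven.two_dvd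
  have hle : Subgroup.zpowers (x : G) ≤ F.residual G := Subgroup.zpowers_le.2 x.2
  have hxn := hnormal _ hle
  have hcard : Nat.card (Subgroup.zpowers (x : G)) = 2 := by
    rw [Nat.card_zpowers, Subgroup.orderOf_coe, hx]
  have hprime : (Nat.card (Subgroup.zpowers (x : G))).Prime := hcard ▸ Nat.prime_two
  have hconj : ∀ g : G, ∀ y ∈ Subgroup.zpowers (x : G), g * y * g⁻¹ = y := fun g y hy =>
    Subgroup.conj_eq_of_card_prime hprime (pow_orderOf_eq_one g)
      (by rw [hcard]; exact Nat.coprime_one_right _) hy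
  let S : NormalSection G := ⟨Subgroup.zpowers (x : G), ⊥, hxn, inferInstance, bot_le⟩
  refine hnc S (isChief_of_card_prime rfl hprime) hle (isCentralFor_of_cent_eq_top hN ?_ ?_)
  · rw [eq_top_iff]
    intro g _
    rw [mem_cent_iff]
    intro y hy
    rw [hconj g y hy, inv_mul_cancel]
    exact S.den.one_mem
  · rw [Subgroup.commutator_le]
    intro g _ y hy
    rw [commutatorElement_def, hconj g y hy, mul_inv_cancel]
    exact S.den.one_mem

/-- By saturation `D` has a complement `M`, and `p ∣ |M|` supplies `a ∈ M` of order `p`. For `1 ≠ d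
∈ D` the diagonal subgroup `⟨da⟩` lies in `latticeOfClass`, and its normal closure connects the
chief factor `D` to a section above `D`, which is `F`-central. -/
theorem not_dvd_index_residual_of_card_prime [Finite G] (hher : F.NormallyHereditary)
    (hsat : F.IsSaturated) (hF : F.IsFormation)
    (hN : ∀ (N : Type u) [Group N] [Finite N], Group.IsNilpotent N → F.Mem N)
    (hL : latticeOfClass F G ⊆ latticeOfSections (chiefFactorsCentralFor F G))
    (hnc : ∀ S : NormalSection G, S.IsChief → S.num ≤ F.residual G → ¬ S.IsCentralFor F)
    (hprime : (Nat.card (F.residual G)).Prime) :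
    ¬ Nat.card (F.residual G) ∣ (F.residual G).index := by
  set D := F.residual G with hD
  set p := Nat.card D with hp
  intro hdvd
  have := Fact.mk hprime
  have hDbot : D ≠ ⊥ := by
    intro h
    rw [hp, h, Subgroup.card_bot] at hprime
    exact Nat.not_prime_one hprime
  have hsub : ∀ N : Subgroup G, N ≤ D → N = ⊥ ∨ N = D := fun N h =>
    Subgroup.eq_bot_or_eq_of_le_of_card_prime hprime h
  let S : NormalSection G := ⟨D, ⊥, inferInstance, inferInstance, bot_le⟩
  have hSchief : S.IsChief := isChief_of_card_prime rfl hprime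
  have hS : ¬ S.IsCentralFor F := hnc S hSchief le_rfl
  have hfrat : ¬ D ≤ frattini G := fun h =>
    hDbot ((GroupClass.mem_iff_residual_eq_bot hF).1 (hsat G h))
  obtain ⟨M, hM, hDM⟩ := exists_isCoatom_not_le hfrat
  have hsup : D ⊔ M = ⊤ := hM.2 _ (lt_of_le_of_ne le_sup_right fun h => hDM (h ▸ le_sup_left))
  have hinf : D ⊓ M = ⊥ := (hsub _ inf_le_left).resolve_right fun h => hDM (inf_eq_left.1 h)
  have hcompl := Subgroup.isComplement'_of_inf_eq_bot_of_sup_eq_top hinf hsup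
  rw [hcompl.symm.index_eq_card] at hdvd
  obtain ⟨⟨a, haM⟩, ha⟩ := exists_prime_orderOf_dvd_card' p hdvd
  rw [← Subgroup.orderOf_coe] at ha
  change orderOf a = p at ha
  have hap : a ^ p = 1 := ha ▸ pow_orderOf_eq_one a
  have haD : a ∉ D := by
    intro h
    have h1 : a ∈ D ⊓ M := ⟨h, haM⟩
    rw [hinf, Subgroup.mem_bot] at h1
    rw [h1, orderOf_one] at ha
    exact hprime.one_lt.ne ha
  -- Elements with trivial `p`-th power therefore centralize `D`; this applies to `a` and to the
  -- elements of `D`.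
  have hcop : p.Coprime (p - 1) := (Nat.coprime_self_sub_right hprime.one_lt.le).2
    (Nat.coprime_one_right p)
  let C := Subgroup.centralizer (D : Set G)
  have hCn : C.Normal := inferInstance
  have hDC : D ≤ C := by
    intro x hx
    rw [Subgroup.mem_centralizer_iff]
    intro y hy
    have h1 := Subgroup.conj_eq_of_card_prime hprime (g := y)
      (congrArg Subtype.val (pow_card_eq_one' (x := (⟨y, hy⟩ : D)))) hcop hx
    exact mul_inv_eq_iff_eq_mul.1 h1
  have haC : a ∈ C := by
    rw [Subgroup.mem_centralizer_iff]
    intro y hy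
    exact (mul_inv_eq_iff_eq_mul.1 (Subgroup.conj_eq_of_card_prime hprime hap hcop hy)).symm
  have hK : (C ⊓ M).Normal := by
    refine ⟨fun n hn g => ?_⟩
    obtain ⟨d, hd, m, hm, rfl⟩ := Subgroup.mem_sup_of_normal_left.1 (hsup ▸ Subgroup.mem_top g)
    have h1 : m * n * m⁻¹ ∈ C ⊓ M :=
      ⟨hCn.conj_mem n hn.1 m, M.mul_mem (M.mul_mem hm hn.2) (M.inv_mem hm)⟩
    have h2 : d * m * n * (d * m)⁻¹ = d * (m * n * m⁻¹) * d⁻¹ := by group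
    rw [h2, Subgroup.mem_centralizer_iff.1 h1.1 d hd, mul_inv_cancel_right]
    exact h1
  set K := C ⊓ M with hKdef
  have hDK : D ⊓ K = ⊥ := le_bot_iff.1 ((inf_le_inf_left D inf_le_right).trans hinf.le)
  have hC : D ⊔ K = C := by
    refine le_antisymm (sup_le hDC inf_le_left) fun c hc => ?_
    obtain ⟨d, hd, m, hm, rfl⟩ := Subgroup.mem_sup_of_normal_left.1 (hsup ▸ Subgroup.mem_top c)
    exact Subgroup.mul_mem_sup hd ⟨(C.mul_mem_cancel_left (hDC hd)).1 hc, hm⟩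
  -- `C/D` is in `F` as a normal subgroup of `G/D`, and `C/K` is in `F` as a `p`-group. The residual
  -- of `C` is thus contained in `D ⊓ K = ⊥`.
  have hCF : F.Mem C := by
    rw [GroupClass.mem_iff_residual_eq_bot hF, eq_bot_iff]
    intro c hc
    let f := (QuotientGroup.mk' D).comp C.subtype
    have hf : f.range.Normal := by
      rw [MonoidHom.range_comp, Subgroup.range_subtype]
      exact hCn.map _ (QuotientGroup.mk'_surjective D)
    have h1 : F.Mem f.range := hher _ ((GroupClass.mem_quotient_iff hF D).2 le_rfl) _ hf
    have h2 := (GroupClass.mem_iff_residual_le_ker hF _ f.rangeRestrict_surjective).1 h1 hc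
    rw [MonoidHom.ker_rangeRestrict] at h2
    have hcD : (c : G) ∈ D := (QuotientGroup.eq_one_iff (c : G)).1 h2
    have h3 : F.Mem (C ⧸ K.subgroupOf C) := by
      apply hN
      have h4 : Nat.card (C ⧸ K.subgroupOf C) ∣ p ^ 1 := by
        rw [← Subgroup.index_eq_card, pow_one, ← Subgroup.relIndex, ← hC,
          Subgroup.relIndex_sup_right]
        exact Subgroup.relIndex_dvd_card K D
      obtain ⟨k, -, hk⟩ := (Nat.dvd_prime_pow hprime).1 h4
      exact (IsPGroup.of_card hk).isNilpotent
    have hcK : (c : G) ∈ K := GroupClass.residual_le h3 hc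
    have h5 : (c : G) ∈ D ⊓ K := ⟨hcD, hcK⟩
    rw [hDK, Subgroup.mem_bot] at h5
    exact Subtype.ext h5
  obtain ⟨d, hd, hd1⟩ := D.bot_or_exists_ne_one.resolve_left hDbot
  have hda : Commute d a := Subgroup.mem_centralizer_iff.1 haC d hd
  have hdaD : d * a ∉ D := fun h => haD ((D.mul_mem_cancel_left hd).1 h)
  have hdap : (d * a) ^ p = 1 := by
    rw [hda.mul_pow, hap, mul_one]
    exact congrArg Subtype.val (pow_card_eq_one' (x := (⟨d, hd⟩ : D)))
  have hcardA : Nat.card (Subgroup.zpowers (d * a)) = p := by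
    rw [Nat.card_zpowers]
    exact orderOf_eq_prime hdap fun h => hdaD (h ▸ D.one_mem)
  set A := Subgroup.zpowers (d * a) with hA
  have hdaA : d * a ∈ A := Subgroup.mem_zpowers _
  let X := Subgroup.normalClosure (A : Set G)
  have hAX : A ≤ X := Subgroup.le_normalClosure
  have hXC : X ≤ C := Subgroup.normalClosure_le_normal
    (Subgroup.zpowers_le.2 (C.mul_mem (hDC hd) haC))
  have hAL : A ∈ latticeOfClass F G := by
    have h1 : F.Mem (X.subgroupOf C) := hher C hCF _ inferInstance
    have h2 : F.Mem X := h1.of_mulEquiv (Subgroup.subgroupOfEquivOfLe hXC)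
    exact GroupClass.Mem.of_surjective hF h2
      (QuotientGroup.mk' (A.normalCore.subgroupOf X)) (QuotientGroup.mk'_surjective _)
  -- The core of `A` is trivial: otherwise `A` is normal of order `p` and contains `D`, so `A = D`,
  -- against `da ∉ D`. With `D ≤ X` the lattice hypothesis would then make `D` an `F`-central chief
  -- factor.
  have hDX : ¬ D ≤ X := by
    intro h
    have hcore : A.normalCore = ⊥ := by
      refine (Subgroup.eq_bot_or_eq_of_le_of_card_prime (hcardA ▸ hprime)
        A.normalCore_le).resolve_right fun h1 => hdaD ?_
      have hAn : A.Normal := h1 ▸ A.normalCore_normal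
      have h2 : D ≤ A := by rwa [← Subgroup.normalClosure_eq_self A]
      rw [Subgroup.eq_of_le_of_card_ge h2 hcardA.le]
      exact hdaA
    exact hS (hL hAL S hSchief hcore.le h).2
  have hDXbot : D ⊓ X = ⊥ := (hsub _ inf_le_left).resolve_right fun h => hDX (inf_eq_left.1 h)
  have hXK : X ⊔ K = C := by
    refine le_antisymm (sup_le hXC inf_le_left) ?_
    rw [← hC]
    refine sup_le ?_ le_sup_right
    rw [← inf_eq_left]
    -- `d = (da)a⁻¹` lies in `XK`, so `XK` meets `D` nontrivially.
    refine (hsub _ inf_le_left).resolve_left fun h => hd1 ?_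
    rw [← Subgroup.mem_bot, ← h]
    refine ⟨hd, ?_⟩
    have h1 : d * a * a⁻¹ ∈ X ⊔ K := Subgroup.mul_mem_sup (hAX hdaA) (K.inv_mem ⟨haC, haM⟩)
    rwa [mul_inv_cancel_right] at h1
  have hinter : X ⊓ (X ⊓ K ⊔ D) = X ⊓ K := by
    refine le_antisymm ?_ (le_inf inf_le_left le_sup_left)
    rintro x ⟨hx, hx'⟩
    obtain ⟨k, hk, e, he, rfl⟩ := Subgroup.mem_sup_of_normal_right.1 hx'
    have h1 : e ∈ D ⊓ X := ⟨he, (X.mul_mem_cancel_left hk.1).1 hx⟩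
    rw [hDXbot, Subgroup.mem_bot] at h1
    rwa [h1, mul_one]
  -- The chain of `G`-isomorphic sections is `D/1`, `C/K`, `X/(X ⊓ K)`, `XD/(X ⊓ K)D`. The last has
  -- a denominator containing the residual, so it is `F`-central.
  let S₂ : NormalSection G := ⟨C, K, inferInstance, hK, inf_le_left⟩
  let S₃ : NormalSection G := ⟨X, X ⊓ K, inferInstance, inferInstance, inf_le_left⟩
  let S₄ : NormalSection G := ⟨X ⊔ (X ⊓ K ⊔ D), X ⊓ K ⊔ D, inferInstance, inferInstance,
    le_sup_right⟩
  have h4 : S₄.IsCentralFor F :=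
    isCentralFor_of_mem hF S₄ ((GroupClass.mem_quotient_iff hF _).2 le_sup_right)
  exact hS ((isCentralFor_of_perspective S S₂ hDK hC).2
    ((isCentralFor_of_perspective S₃ S₂ rfl hXK).1
      ((isCentralFor_of_perspective S₃ S₄ hinter rfl).2 h4)))

/-- For a prime `p` dividing both order and index, factor out a subgroup of index `p` in the abelian
residual, normal in `G` by hypothesis. The quotient has residual of order `p` and the same index. -/
theorem isHallSubgroup_residual [Finite G] (hher : F.NormallyHereditary)
    (hsat : F.IsSaturated) (hF : F.IsFormation)
    (hN : ∀ (N : Type u) [Group N] [Finite N], Group.IsNilpotent N → F.Mem N)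
    (hL : latticeOfClass F G ⊆ latticeOfSections (chiefFactorsCentralFor F G))
    (hnc : ∀ S : NormalSection G, S.IsChief → S.num ≤ F.residual G → ¬ S.IsCentralFor F)
    (hnormal : ∀ A : Subgroup G, A ≤ F.residual G → A.Normal) :
    IsHallSubgroup (F.residual G) := by
  by_contra hcon
  obtain ⟨p, hp, hp1, hp2⟩ := Nat.Prime.not_coprime_iff_dvd.1 hcon
  let _ : CommGroup (F.residual G) :=
    { (inferInstance : Group (F.residual G)) with
      mul_comm := fun x y => Subtype.ext (residual_commute hN hnormal x.2 y.2) }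
  obtain ⟨W, hW⟩ := exists_subgroup_index_eq_of_dvd hp1
  have hWn : (W.map (F.residual G).subtype).Normal := hnormal _ (Subgroup.map_subtype_le W)
  let π := QuotientGroup.mk' (W.map (F.residual G).subtype)
  have hπ : Function.Surjective π := QuotientGroup.mk'_surjective _
  have hres := GroupClass.map_residual hF π hπ
  have hker : π.ker = W.map (F.residual G).subtype := QuotientGroup.ker_mk' _
  have hcard : Nat.card (F.residual (G ⧸ W.map (F.residual G).subtype)) = p := by
    rw [← hres, ← Subgroup.relIndex_ker, hker, Subgroup.relIndex, Subgroup.subgroupOf,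
      Subgroup.comap_map_eq_self_of_injective (F.residual G).subtype_injective, hW]
  refine not_dvd_index_residual_of_card_prime hher hsat hF hN
    (latticeOfClass_subset_of_surjective hL π hπ) (fun T hT hTle hTF => ?_) (hcard ▸ hp) ?_
  · refine hnc (T.comap π) (hT.comap π hπ) ?_ ((isCentralFor_comap T π hπ).2 hTF)
    have h1 : T.num.comap π ≤ ((F.residual G).map π).comap π :=
      Subgroup.comap_mono (hres ▸ hTle)
    rwa [Subgroup.comap_map_eq_self (hker.le.trans (Subgroup.map_subtype_le W))] at h1
  · rw [hcard, ← hres, Subgroup.index_map, MonoidHom.range_eq_top.2 hπ, Subgroup.index_top,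
      mul_one, hker, sup_eq_left.2 (Subgroup.map_subtype_le W)]
    exact hp2

/-! ### The saturated formation of nilpotent groups. -/

namespace GroupClass

/-- The stable term of the lower central series lies in every normal subgroup with nilpotent
quotient, hence in the residual. -/
theorem nilpotent_isFormation : nilpotent.{u}.IsFormation := by
  intro G _ _ Q _ f hf
  have : Group.IsNilpotent (G ⧸ nilpotent.residual G) := by
    obtain ⟨n, hn⟩ := WellFoundedGT.monotone_chain_condition (α := (Subgroup G)ᵒᵈ)
      ⟨(⊤ : Subgroup G).lowerCentralSeries, Subgroup.lowerCentralSeries_antitone _⟩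
    have hmap : ∀ (N : Subgroup G) [N.Normal] (k : ℕ),
        (⊤ : Subgroup (G ⧸ N)).lowerCentralSeries k =
          ((⊤ : Subgroup G).lowerCentralSeries k).map (QuotientGroup.mk' N) := by
      intro N _ k
      rw [Subgroup.map_lowerCentralSeries,
        Subgroup.map_top_of_surjective _ (QuotientGroup.mk'_surjective N)]
    have hle : ∀ (N : Subgroup G) [N.Normal] (k : ℕ),
        (⊤ : Subgroup (G ⧸ N)).lowerCentralSeries k = ⊥ ↔
          (⊤ : Subgroup G).lowerCentralSeries k ≤ N := by
      intro N _ k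
      rw [hmap, Subgroup.map_eq_bot_iff, QuotientGroup.ker_mk']
    rw [Subgroup.nilpotent_iff_lowerCentralSeries]
    refine ⟨n, (hle _ n).2 (le_iInf fun N => le_iInf fun _ => le_iInf fun hN => ?_)⟩
    obtain ⟨k, hk⟩ := Subgroup.nilpotent_iff_lowerCentralSeries.1 hN.2
    have h1 := (hle N k).1 hk
    have h2 : (⊤ : Subgroup G).lowerCentralSeries n =
        (⊤ : Subgroup G).lowerCentralSeries (max n k) := hn _ (le_max_left n k)
    rw [h2]
    exact (Subgroup.lowerCentralSeries_antitone _ (le_max_right n k)).trans h1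
  exact ⟨Finite.of_surjective f hf, Group.nilpotent_of_surjective f hf⟩

/-- Every maximal subgroup contains the residual, so the normalizer condition in the nilpotent
quotient makes it normal. -/
theorem nilpotent_isSaturated : nilpotent.{u}.IsSaturated := by
  intro G _ _ h
  refine ⟨inferInstance, ?_⟩
  refine ((Group.isNilpotent_of_finite_tfae (G := G)).out 0 2).2 ?_
  intro M hM
  let π := QuotientGroup.mk' (nilpotent.residual G)
  have hπ : Function.Surjective π := QuotientGroup.mk'_surjective _
  have hQ : Group.IsNilpotent (G ⧸ nilpotent.residual G) :=
    ((mem_quotient_iff nilpotent_isFormation _).2 le_rfl).2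
  have hker : π.ker ≤ M :=
    (QuotientGroup.ker_mk' _).le.trans (h.trans (iInf₂_le M hM))
  have hMap := Subgroup.comap_map_eq_self hker
  have hlt : M.map π < ⊤ := by
    rw [← Subgroup.comap_lt_comap_of_surjective hπ, hMap, Subgroup.comap_top]
    exact hM.lt_top
  have h1 := Group.normalizerCondition_of_isNilpotent (M.map π) hlt
  rw [← Subgroup.comap_lt_comap_of_surjective hπ, hMap] at h1
  have h2 := hM.2 _ h1
  have h3 : (M.map π).Normal := by
    rw [← Subgroup.normalizer_eq_top_iff]
    apply Subgroup.comap_injective hπ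
    rw [h2, Subgroup.comap_top]
  rw [← hMap]
  exact h3.comap π

end GroupClass

theorem NormalSection.IsCentral.isCentralFor_nilpotent [Finite G] {S : NormalSection G}
    (h : S.IsCentral) : S.IsCentralFor GroupClass.nilpotent := by
  have hcomm : ∀ (g : G), ∀ x ∈ S.num, x⁻¹ * (g * x * g⁻¹) ∈ S.den := by
    intro g x hx
    have h1 := Subgroup.mem_center_iff.1 (h ⟨x, hx, rfl⟩) (g : G ⧸ S.den)
    have h2 : ((x * g : G) : G ⧸ S.den) = ((g * x : G) : G ⧸ S.den) := h1.symm
    have h3 := S.den_normal.conj_mem _ (QuotientGroup.eq.1 h2) g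
    simpa [mul_assoc] using h3
  refine isCentralFor_of_cent_eq_top (F := GroupClass.nilpotent)
    (fun N _ _ hN => ⟨inferInstance, hN⟩) ?_ ?_
  · rw [eq_top_iff]
    exact fun g _ => S.mem_cent_iff.2 (hcomm g)
  · rw [Subgroup.commutator_le]
    intro g _ x hx
    have h3 := S.den_normal.conj_mem _ (hcomm g x hx) x
    rw [commutatorElement_def]
    simpa [mul_assoc] using h3

theorem theorem1p4 (G : Type u) [Group G] [Finite G] :
    (∀ F : GroupClass.{u}, F.NormallyHereditary → F.IsSaturated → F.IsFormation →
      (∀ (N : Type u) [Group N] [Finite N], Group.IsNilpotent N → F.Mem N) →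
      Group.IsSolvable (F.residual G) →
      latticeOfClass F G ⊆ latticeOfSections (chiefFactorsCentralFor F G) →
      IsMulCommutative (F.residual G) ∧
      IsHallSubgroup (F.residual G) ∧
      Odd (Nat.card (F.residual G)) ∧
      (∀ g : G, IsPowerAutomorphism (conjModFrattini (F.residual G) g)) ∧
      (∀ C : NormalSection G, C.IsChief → C.num ≤ F.residual G → IsCyclic C.Factor)) ∧
    (Group.IsSolvable G →
      latticeOfClass GroupClass.nilpotent G = latticeOfSections (centralChiefFactors G) →
      ∀ g : G, IsPowerAutomorphism
        (MulAut.conjNormal g : MulAut (GroupClass.nilpotent.residual G))) := by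
  constructor
  · intro F hher hsat hF hN hsol hL
    have hnc : ∀ S : NormalSection G, S.IsChief → S.num ≤ F.residual G → ¬ S.IsCentralFor F :=
      fun S hS hle => not_isCentralFor_of_num_le_residual hF hsat hN hsol hL hS hle
    have hnormal : ∀ A : Subgroup G, A ≤ F.residual G → A.Normal := fun A hA =>
      normal_of_le_residual hN (residual_isNilpotent hF hN hsol hL) hL hnc hA
    refine ⟨⟨⟨fun x y => Subtype.ext (residual_commute hN hnormal x.2 y.2)⟩⟩,
      isHallSubgroup_residual hher hsat hF hN hL hnc hnormal,
      odd_card_residual hN hnormal hnc, fun g => ?_, fun C hC hle => ?_⟩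
    · apply isPowerAutomorphism_of_mem
      intro K x hx
      obtain ⟨d, rfl⟩ := QuotientGroup.mk'_surjective _ x
      -- The preimage of `K` in the residual is normal in `G`, so conjugation preserves `K`.
      have hn := hnormal ((K.comap (QuotientGroup.mk' _)).map (F.residual G).subtype)
        (Subgroup.map_subtype_le _)
      obtain ⟨e, he, hed⟩ := hn.conj_mem d ⟨d, hx, rfl⟩ g
      have h1 : e = MulAut.conjNormal g d := Subtype.ext hed
      rw [h1] at he
      exact he
    · exact (hC.isCyclic_or_isCentralFor hN hL (Group.isSolvable_of_isSolvable_injective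
        (Subgroup.inclusion_injective hle))).resolve_right (hnc C hC hle)
  · intro hsol hL g
    have hN : ∀ (N : Type u) [Group N] [Finite N], Group.IsNilpotent N →
        GroupClass.nilpotent.Mem N := fun N _ _ h => ⟨inferInstance, h⟩
    -- Central chief factors are central for the nilpotent class, which brings the hypothesis into
    -- the form used for a general formation.
    have hL' : latticeOfClass GroupClass.nilpotent G ⊆
        latticeOfSections (chiefFactorsCentralFor GroupClass.nilpotent G) :=
      fun A hA C hC h1 h2 => ⟨hC, ((hL ▸ hA : A ∈ latticeOfSections _) C hC h1 h2).2
        |>.isCentralFor_nilpotent⟩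
    have hF := GroupClass.nilpotent_isFormation.{u}
    have hsolD : Group.IsSolvable (GroupClass.nilpotent.residual G) := inferInstance
    have hnormal : ∀ A : Subgroup G, A ≤ GroupClass.nilpotent.residual G → A.Normal :=
      fun A hA => normal_of_le_residual hN (residual_isNilpotent hF hN hsolD hL') hL'
        (fun S hS hle => not_isCentralFor_of_num_le_residual hF
          GroupClass.nilpotent_isSaturated hN hsolD hL' hS hle) hA
    apply isPowerAutomorphism_of_mem
    intro K x hx
    have hn := hnormal (K.map (GroupClass.nilpotent.residual G).subtype)
      (Subgroup.map_subtype_le _)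
    obtain ⟨e, he, hed⟩ := hn.conj_mem x ⟨x, hx, rfl⟩ g
    have h1 : e = MulAut.conjNormal g x := Subtype.ext hed
    exact h1 ▸ he
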